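/- Let $\Omega\subset\mathbb R^d$ be closed and convex, and let $\mathcal M(\Omega)$ denote the finite nonnegative Borel measures on $\Omega$. Let $\mathfrak C=(\Omega\times[0,\infty))/(\Omega\times\{0\})$ be the cone over $\Omega$, with points $z=[x,r]$ and metric $$\mathsf d_{\mathfrak C}([x_0,r_0],[x_1,r_1])^2=r_0^2+r_1^2-2r_0r_1\cos_\pi(|x_1-x_0|),\qquad \cos_\pi(L)=\cos(\min\{L,\pi\}).$$ Let $\mathcal M_2(\mathfrak C)$ be the finite nonnegative Borel measures $\lambda$ on $\mathfrak C$ with $\int r^2\,d\lambda<\infty$, and define $\mathfrak P:\mathcal M_2(\mathfrak C)\to\mathcal M(\Omega)$ by $\int_\Omega\phi\,d\mathfrak P\lambda=\int_{\mathfrak C}r^2\phi(x)\,d\lambda([x,r])$ for all bounded continuous $\phi$; $\lambda$ is a lift of $\mu$ if $\mathfrak P\lambda=\mu$. Set $$\mathsf W_{\mathfrak C}(\lambda_0,\lambda_1)^2=\inf\Big\{\iint \mathsf d_{\mathfrak C}(z_0,z_1)^2\,d\gamma \;\Big|\; \gamma \text{ a finite nonnegative Borel measure on } \mathfrak C\times\mathfrak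 C \text{ with marginals } \lambda_0,\lambda_1\Big\}$$ ($=\infty$ if $\lambda_0(\mathfrak C)\ne\lambda_1(\mathfrak C)$), and define the Hellinger--Kantorovich distance by $$\mathsf{HK}(\mu_0,\mu_1)=\inf\{\mathsf W_{\mathfrak C}(\lambda_0,\lambda_1)\mid \lambda_i\in\mathcal M_2(\mathfrak C),\ \mathfrak P\lambda_0=\mu_0,\ \mathfrak P\lambda_1=\mu_1\}.$$ For $s\in[0,1]$ and $z_i=[x_i,r_i]$ let $Z(s;z_0,z_1)=[(1-\rho)x_0+\rho x_1,\,R]$ with $$R^2=(1-s)^2r_0^2+s^2r_1^2+2s(1-s)r_0r_1\cos_\pi(|x_1-x_0|),$$ $$\rho=\begin{cases}\dfrac1{|x_1-x_0|}\arccos\Big(\dfrac{(1-s)r_0+sr_1\cos|x_1-x_0|}{R}\Big)&\text{if } |x_1-x_0|<\pi,\\[2mm] \tfrac12\big(1-\operatorname{sign}((1-s)r_0-sr_1)\big)&\text{if } |x_1-x_0|\ge\pi\end{cases}$$ (for $R=0$ the point is the tip of the cone and $\rho$ is irrelevant, and so it is for $x_0=x_1$); this is well defined on $\mathfrak C\times\mathfrak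 C$. **Theorem.** Let $\mu_0,\mu_1\in\mathcal M(\Omega)$, let $\lambda_0,\lambda_1\in\mathcal M_2(\mathfrak C)$ be optimal lifts, i.e. $\mathfrak P\lambda_i=\mu_i$ and $\mathsf W_{\mathfrak C}(\lambda_0,\lambda_1)=\mathsf{HK}(\mu_0,\mu_1)$, and let $\gamma$ be an optimal transport plan for $\mathsf W_{\mathfrak C}(\lambda_0,\lambda_1)$. Then $\mu(s)=\mathfrak P\big(Z(s;\cdot,\cdot)_\#\gamma\big)$, $s\in[0,1]$, is a constant-speed geodesic in $\mathcal M(\Omega)$ connecting $\mu_0$ and $\mu_1$: each $\mu(s)$ is a finite measure, $\mu(0)=\mu_0$, $\mu(1)=\mu_1$, $\mathsf{HK}(\mu_0,\mu_1)<\infty$, and $$\mathsf{HK}(\mu(s),\mu(t))=|t-s|\,\mathsf{HK}(\mu_0,\mu_1)\qquad\text{for all } s,t\in[0,1].$$ -/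

import Mathlib

open MeasureTheory
open scoped ENNReal NNReal unitInterval

noncomputable section

namespace HellingerKantorovich

/-- The truncated cosine `cos_π L = cos (min |L| π)`. -/
def cosPi (L : ℝ) : ℝ := Real.cos (min |L| Real.pi)

theorem cosPi_le_one (L : ℝ) : cosPi L ≤ 1 := Real.cos_le_one _

theorem cosPi_of_le {L : ℝ} (h0 : 0 ≤ L) (h : L ≤ Real.pi) : cosPi L = Real.cos L := by
  rw [cosPi, abs_of_nonneg h0, min_eq_left h]

theorem cosPi_of_ge {L : ℝ} (h : Real.pi ≤ L) : cosPi L = -1 := by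
  rw [cosPi, abs_of_nonneg (Real.pi_pos.le.trans h), min_eq_right h, Real.cos_pi]

theorem cosPi_anti {L M : ℝ} (h0 : 0 ≤ L) (h : L ≤ M) : cosPi M ≤ cosPi L := by
  rw [cosPi, cosPi, abs_of_nonneg h0, abs_of_nonneg (h0.trans h)]
  exact Real.cos_le_cos_of_nonneg_of_le_pi (le_min h0 Real.pi_pos.le) (min_le_right _ _)
    (min_le_min_right _ h)

theorem neg_one_le_cosPi (L : ℝ) : -1 ≤ cosPi L := Real.neg_one_le_cos _

/-! ### The cone over a metric space -/

/-- The equivalence relation on `X × [0,∞)` that identifies all points of `X × {0}`. -/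
def coneSetoid (X : Type*) : Setoid (X × ℝ≥0) where
  r p q := p = q ∨ (p.2 = 0 ∧ q.2 = 0)
  iseqv :=
    { refl := fun _ => Or.inl rfl
      symm := by
        rintro p q (h | h)
        · exact Or.inl h.symm
        · exact Or.inr h.symm
      trans := by
        rintro p q r (rfl | h) (rfl | h')
        · exact Or.inl rfl
        · exact Or.inr h'
        · exact Or.inr h
        · exact Or.inr ⟨h.1, h'.2⟩ }

/-- The cone `(X × [0,∞)) / (X × {0})`. -/
def Cone (X : Type*) : Type _ := Quotient (coneSetoid X)

/-- The point `[x, r]` of the cone. -/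
def Cone.mk {X : Type*} (x : X) (r : ℝ≥0) : Cone X := Quotient.mk (coneSetoid X) (x, r)

/-- The radial coordinate, `[x, r] ↦ r`. -/
def Cone.radius {X : Type*} : Cone X → ℝ≥0 :=
  Quotient.lift Prod.snd (by
    rintro p q (rfl | h)
    · rfl
    · exact h.1.trans h.2.symm)

/-- The base point, `[x, r] ↦ x` for `r > 0`; its value at the tip is an arbitrary point of `X`. -/
def Cone.point {X : Type*} (z : Cone X) : X := (Quotient.out z).1

theorem Cone.ind {X : Type*} {p : Cone X → Prop} (h : ∀ x r, p (Cone.mk x r)) (z : Cone X) :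
    p z :=
  Quotient.inductionOn z fun q => h q.1 q.2

@[simp] theorem Cone.radius_mk {X : Type*} (x : X) (r : ℝ≥0) : (Cone.mk x r).radius = r := rfl

theorem Cone.mk_zero {X : Type*} (x y : X) : Cone.mk x 0 = Cone.mk y 0 :=
  Quotient.sound (Or.inr ⟨rfl, rfl⟩)

theorem Cone.mk_point_radius {X : Type*} (z : Cone X) : Cone.mk z.point z.radius = z := by
  have h : Quotient.mk (coneSetoid X) (Quotient.out z) = z := Quotient.out_eq z
  have h2 : z.radius = (Quotient.out z).2 := by
    conv_lhs => rw [← h]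
    rfl
  rw [h2]
  exact h

theorem Cone.point_mk {X : Type*} (x : X) {r : ℝ≥0} (hr : r ≠ 0) : (Cone.mk x r).point = x := by
  have h := Quotient.exact (Cone.mk_point_radius (Cone.mk x r))
  rcases h with h | h
  · exact congrArg Prod.fst h
  · exact absurd h.2 hr

/-- The expression `(r₀² + r₁² - 2 r₀ r₁ cos_π L)^(1/2)`. -/
def coneDistAux (r₀ r₁ L : ℝ) : ℝ := Real.sqrt (r₀ ^ 2 + r₁ ^ 2 - 2 * r₀ * r₁ * cosPi L)

/-- The cone distance
`d([x₀, r₀], [x₁, r₁]) = (r₀² + r₁² - 2 r₀ r₁ cos_π (dist x₀ x₁))^(1/2)`. -/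
def coneDist {X : Type*} [MetricSpace X] : Cone X → Cone X → ℝ :=
  Quotient.lift₂ (fun p q => coneDistAux p.2 q.2 (dist p.1 q.1)) (by
    rintro p q p' q' (rfl | h) (rfl | h')
    · rfl
    · simp [coneDistAux, h'.1, h'.2]
    · simp [coneDistAux, h.1, h.2]
    · simp [coneDistAux, h.1, h.2, h'.1, h'.2])

theorem coneDist_mk {X : Type*} [MetricSpace X] (x y : X) (r s : ℝ≥0) :
    coneDist (Cone.mk x r) (Cone.mk y s) = coneDistAux r s (dist x y) := rfl

theorem coneDistAux_anti {r₀ r₁ L M : ℝ} (h₀ : 0 ≤ r₀) (h₁ : 0 ≤ r₁) (hL : 0 ≤ L) (h : L ≤ M) :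
    coneDistAux r₀ r₁ L ≤ coneDistAux r₀ r₁ M := by
  apply Real.sqrt_le_sqrt
  have := mul_le_mul_of_nonneg_left (cosPi_anti hL h) (by positivity : 0 ≤ 2 * r₀ * r₁)
  linarith

theorem coneDistAux_of_ge {r₀ r₁ L : ℝ} (h₀ : 0 ≤ r₀) (h₁ : 0 ≤ r₁) (h : Real.pi ≤ L) :
    coneDistAux r₀ r₁ L = r₀ + r₁ := by
  rw [coneDistAux, cosPi_of_ge h]
  rw [show r₀ ^ 2 + r₁ ^ 2 - 2 * r₀ * r₁ * (-1) = (r₀ + r₁) ^ 2 by ring]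
  exact Real.sqrt_sq (by positivity)

theorem abs_sub_le_coneDistAux {r₀ r₁ : ℝ} (h₀ : 0 ≤ r₀) (h₁ : 0 ≤ r₁) (L : ℝ) :
    |r₀ - r₁| ≤ coneDistAux r₀ r₁ L := by
  apply Real.abs_le_sqrt
  have := mul_le_mul_of_nonneg_left (cosPi_le_one L) (by positivity : 0 ≤ 2 * r₀ * r₁)
  nlinarith

theorem norm_polar_sub (r₀ r₁ a b : ℝ) :
    ‖(r₀ : ℂ) * Complex.exp (a * Complex.I) - r₁ * Complex.exp (b * Complex.I)‖
      = Real.sqrt (r₀ ^ 2 + r₁ ^ 2 - 2 * r₀ * r₁ * Real.cos (a - b)) := by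
  rw [Complex.norm_def, Complex.normSq_apply]
  congr 1
  simp only [Complex.sub_re, Complex.sub_im, Complex.re_ofReal_mul, Complex.im_ofReal_mul,
    Complex.exp_ofReal_mul_I_re, Complex.exp_ofReal_mul_I_im, Real.cos_sub]
  linear_combination r₀ ^ 2 * Real.sin_sq_add_cos_sq a + r₁ ^ 2 * Real.sin_sq_add_cos_sq b

theorem coneDistAux_triangle_of_le_pi {r₀ r₁ r₂ L M : ℝ} (hL : 0 ≤ L) (hM : 0 ≤ M)
    (h : L + M ≤ Real.pi) :
    coneDistAux r₀ r₂ (L + M) ≤ coneDistAux r₀ r₁ L + coneDistAux r₁ r₂ M := by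
  have key := norm_sub_le_norm_sub_add_norm_sub
    ((r₀ : ℂ) * Complex.exp ((L : ℝ) * Complex.I)) (r₁ * Complex.exp ((0 : ℝ) * Complex.I))
    (r₂ * Complex.exp ((-M : ℝ) * Complex.I))
  rw [norm_polar_sub, norm_polar_sub, norm_polar_sub] at key
  rw [coneDistAux, coneDistAux, coneDistAux, cosPi_of_le (by positivity) h,
    cosPi_of_le hL (by linarith), cosPi_of_le hM (by linarith)]
  simpa using key

theorem coneDistAux_triangle {r₀ r₁ r₂ L M N : ℝ} (h₀ : 0 ≤ r₀) (h₁ : 0 ≤ r₁) (h₂ : 0 ≤ r₂)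
    (hL : 0 ≤ L) (hM : 0 ≤ M) (hN : 0 ≤ N) (h : N ≤ L + M) :
    coneDistAux r₀ r₂ N ≤ coneDistAux r₀ r₁ L + coneDistAux r₁ r₂ M := by
  refine (coneDistAux_anti h₀ h₂ hN h).trans ?_
  rcases le_total (L + M) Real.pi with hp | hp
  · exact coneDistAux_triangle_of_le_pi hL hM hp
  · rw [coneDistAux_of_ge h₀ h₂ hp]
    rcases le_total L Real.pi with hLp | hLp
    · have h3 := coneDistAux_triangle_of_le_pi (r₀ := r₀) (r₁ := r₁) (r₂ := r₂) hL
        (sub_nonneg.2 hLp) (by linarith : L + (Real.pi - L) ≤ Real.pi)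
      rw [coneDistAux_of_ge h₀ h₂ (by linarith)] at h3
      have h4 := coneDistAux_anti h₁ h₂ (sub_nonneg.2 hLp) (by linarith : Real.pi - L ≤ M)
      linarith
    · rw [coneDistAux_of_ge h₀ h₁ hLp]
      have h3 := (le_abs_self _).trans ((abs_sub_comm r₂ r₁).le.trans
        (abs_sub_le_coneDistAux h₁ h₂ M))
      linarith

theorem eq_of_coneDistAux_eq_zero {r₀ r₁ L : ℝ} (h₀ : 0 ≤ r₀) (h₁ : 0 ≤ r₁) (hL : 0 ≤ L)
    (h : coneDistAux r₀ r₁ L = 0) : r₀ = r₁ ∧ (r₀ = 0 ∨ L = 0) := by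
  have e : r₀ = r₁ := by
    have := abs_sub_le_coneDistAux h₀ h₁ L
    rw [h] at this
    exact sub_eq_zero.1 (abs_nonpos_iff.1 this)
  refine ⟨e, ?_⟩
  subst e
  by_contra! hc
  have hpos : 0 < r₀ := lt_of_le_of_ne h₀ (Ne.symm hc.1)
  have hLpos : 0 < L := lt_of_le_of_ne hL (Ne.symm hc.2)
  have hcos : cosPi L < 1 := by
    rw [cosPi, abs_of_nonneg hL, ← Real.cos_zero]
    exact Real.cos_lt_cos_of_nonneg_of_le_pi le_rfl (min_le_right _ _) (lt_min hLpos Real.pi_pos)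
  have : 0 < coneDistAux r₀ r₀ L := by
    apply Real.sqrt_pos.2
    have := mul_pos (mul_pos hpos hpos) (sub_pos.2 hcos)
    nlinarith
  exact this.ne' h

instance Cone.instMetricSpace {X : Type*} [MetricSpace X] : MetricSpace (Cone X) where
  dist := coneDist
  dist_self z := by
    induction z using Cone.ind with | h x r => ?_
    rw [coneDist_mk, coneDistAux, dist_self, cosPi_of_le le_rfl Real.pi_pos.le, Real.cos_zero,
      Real.sqrt_eq_zero']
    exact le_of_eq (by ring)
  dist_comm z w := by
    induction z using Cone.ind with | h x r => ?_
    induction w using Cone.ind with | h y s => ?_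
    rw [coneDist_mk, coneDist_mk, coneDistAux, coneDistAux, dist_comm x y]
    congr 1
    ring
  dist_triangle z w v := by
    induction z using Cone.ind with | h x r => ?_
    induction w using Cone.ind with | h y s => ?_
    induction v using Cone.ind with | h u t => ?_
    exact coneDistAux_triangle r.2 s.2 t.2 dist_nonneg dist_nonneg dist_nonneg
      (dist_triangle _ _ _)
  eq_of_dist_eq_zero {z w} := by
    induction z using Cone.ind with | h x r => ?_
    induction w using Cone.ind with | h y s => ?_
    intro h
    obtain ⟨e, h'⟩ := eq_of_coneDistAux_eq_zero r.2 s.2 dist_nonneg h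
    obtain rfl : r = s := NNReal.coe_injective e
    rcases h' with h' | h'
    · obtain rfl : r = 0 := NNReal.coe_injective h'
      exact Cone.mk_zero x y
    · exact congrArg (fun u => Cone.mk u r) (dist_eq_zero.1 h')

instance Cone.instMeasurableSpace {X : Type*} [MetricSpace X] : MeasurableSpace (Cone X) :=
  borel _

instance Cone.instBorelSpace {X : Type*} [MetricSpace X] : BorelSpace (Cone X) := ⟨rfl⟩

/-! ### Measures on the cone and the Hellinger–Kantorovich distance -/

/-- Membership in `𝓜₂` of the cone: finite Borel measures with `∫ r² dλ < ∞`. -/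
structure MemM2 {X : Type*} [MetricSpace X] (l : Measure (Cone X)) : Prop where
  finite : IsFiniteMeasure l
  moment : ∫⁻ z, (z.radius : ℝ≥0∞) ^ 2 ∂l < ∞

/-- The projection `𝔓`: the measure `𝔓 λ` with `∫ φ d(𝔓 λ) = ∫ r² φ(x) dλ([x, r])`. The weight
`r²` vanishes at the tip, so the value of `Cone.point` there plays no role. -/
def proj {X : Type*} [MetricSpace X] [MeasurableSpace X] (l : Measure (Cone X)) : Measure X :=
  (l.withDensity fun z => (z.radius : ℝ≥0∞) ^ 2).map Cone.point

/-- `l` is a lift of `μ`. -/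
def IsLift {X : Type*} [MetricSpace X] [MeasurableSpace X] (l : Measure (Cone X))
    (μ : Measure X) : Prop :=
  MemM2 l ∧ proj l = μ

/-- `γ` is a transport plan between `l₀` and `l₁`. -/
structure IsPlan {X : Type*} [MetricSpace X] (γ : Measure (Cone X × Cone X))
    (l₀ l₁ : Measure (Cone X)) : Prop where
  finite : IsFiniteMeasure γ
  map_fst : γ.map Prod.fst = l₀
  map_snd : γ.map Prod.snd = l₁

/-- The quadratic transport cost of a plan for the cone distance. -/
def planCost {X : Type*} [MetricSpace X] (γ : Measure (Cone X × Cone X)) : ℝ≥0∞ :=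
  ∫⁻ p, edist p.1 p.2 ^ 2 ∂γ

/-- The Kantorovich–Wasserstein distance on the cone; it is `∞` if the total masses of the two
measures differ, since there is no plan then. -/
def wass {X : Type*} [MetricSpace X] (l₀ l₁ : Measure (Cone X)) : ℝ≥0∞ :=
  (⨅ (γ : Measure (Cone X × Cone X)) (_ : IsPlan γ l₀ l₁), planCost γ) ^ (1 / 2 : ℝ)

/-- The Hellinger–Kantorovich distance. -/
def hk {X : Type*} [MetricSpace X] [MeasurableSpace X] (μ₀ μ₁ : Measure X) : ℝ≥0∞ :=
  ⨅ (l₀ : Measure (Cone X)) (l₁ : Measure (Cone X)) (_ : IsLift l₀ μ₀) (_ : IsLift l₁ μ₁),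
    wass l₀ l₁

/-- `l₀` and `l₁` are optimal lifts of `μ₀` and `μ₁`: they attain the minimum in `hk`. -/
structure AreOptimalLifts {X : Type*} [MetricSpace X] [MeasurableSpace X]
    (l₀ l₁ : Measure (Cone X)) (μ₀ μ₁ : Measure X) : Prop where
  lift₀ : IsLift l₀ μ₀
  lift₁ : IsLift l₁ μ₁
  optimal : wass l₀ l₁ = hk μ₀ μ₁

/-- `γ` is an optimal transport plan between `l₀` and `l₁`: it attains the minimum in `wass`. -/
structure IsOptimalPlan {X : Type*} [MetricSpace X] (γ : Measure (Cone X × Cone X))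
    (l₀ l₁ : Measure (Cone X)) : Prop where
  plan : IsPlan γ l₀ l₁
  optimal : planCost γ = wass l₀ l₁ ^ 2

/-! ### The geodesic interpolator on the cone -/

/-- `R = ((1-s)² r₀² + s² r₁² + 2 s (1-s) r₀ r₁ cos_π L)^(1/2)`. -/
def interpRadius (s r₀ r₁ L : ℝ) : ℝ :=
  Real.sqrt ((1 - s) ^ 2 * r₀ ^ 2 + s ^ 2 * r₁ ^ 2 + 2 * s * (1 - s) * r₀ * r₁ * cosPi L)

/-- The weight `ρ` of the second base point. For `R = 0` the interpolated point is the tip, and the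
value of `ρ` plays no role; likewise for `L = 0`, where the two base points agree. -/
def interpWeight (s r₀ r₁ L : ℝ) : ℝ :=
  if interpRadius s r₀ r₁ L = 0 then 0
  else if L < Real.pi then
    1 / L * Real.arccos (((1 - s) * r₀ + s * r₁ * Real.cos L) / interpRadius s r₀ r₁ L)
  else 1 / 2 * (1 - Real.sign ((1 - s) * r₀ - s * r₁))

theorem interpWeight_mem {s r₀ r₁ L : ℝ} (hs : s ∈ Set.Icc (0 : ℝ) 1) (h₀ : 0 ≤ r₀) (h₁ : 0 ≤ r₁)
    (hL : 0 ≤ L) : interpWeight s r₀ r₁ L ∈ Set.Icc (0 : ℝ) 1 := by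
  unfold interpWeight
  split_ifs with hR hlt
  · simp
  · rcases hL.eq_or_lt with rfl | hpos
    · simp
    have hRpos : 0 < interpRadius s r₀ r₁ L :=
      lt_of_le_of_ne (Real.sqrt_nonneg _) (Ne.symm hR)
    refine ⟨mul_nonneg (by positivity) (Real.arccos_nonneg _), ?_⟩
    rw [one_div, inv_mul_le_iff₀ hpos, mul_one]
    conv_rhs => rw [← Real.arccos_cos hL hlt.le]
    apply Real.arccos_le_arccos
    rw [le_div_iff₀ hRpos]
    have ha : 0 ≤ (1 - s) * r₀ := mul_nonneg (by linarith [hs.2]) h₀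
    have hb : 0 ≤ s * r₁ := mul_nonneg hs.1 h₁
    have hc : Real.cos L ^ 2 ≤ 1 := Real.cos_sq_le_one L
    have hsq : interpRadius s r₀ r₁ L ^ 2
        = ((1 - s) * r₀) ^ 2 + (s * r₁) ^ 2 + 2 * ((1 - s) * r₀) * (s * r₁) * Real.cos L := by
      rw [interpRadius, Real.sq_sqrt, cosPi_of_le hL hlt.le]
      · ring
      · have := mul_le_mul_of_nonneg_left (neg_one_le_cosPi L) (mul_nonneg ha hb)
        nlinarith [sq_nonneg ((1 - s) * r₀ - s * r₁)]
    generalize (1 - s) * r₀ = a at *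
    generalize s * r₁ = b at *
    generalize Real.cos L = c at *
    generalize interpRadius s r₀ r₁ L = R at *
    have hid : (a + b * c) ^ 2 - (c * R) ^ 2 = (1 - c ^ 2) * (a * (a + 2 * (b * c))) := by
      rw [mul_pow, hsq]; ring
    have hc1 : 0 ≤ 1 - c ^ 2 := by linarith
    rcases le_total 0 c with hc0 | hc0
    · have hbc : 0 ≤ b * c := mul_nonneg hb hc0
      have h2 : 0 ≤ (1 - c ^ 2) * (a * (a + 2 * (b * c))) := by positivity
      exact le_of_pow_le_pow_left₀ two_ne_zero (by positivity) (by linarith)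
    · rcases le_total 0 (a + b * c) with h3 | h3
      · exact (mul_nonpos_of_nonpos_of_nonneg hc0 hRpos.le).trans h3
      · have hbc : b * c ≤ 0 := mul_nonpos_of_nonneg_of_nonpos hb hc0
        have h2 : (1 - c ^ 2) * (a * (a + 2 * (b * c))) ≤ 0 :=
          mul_nonpos_of_nonneg_of_nonpos hc1
            (mul_nonpos_of_nonneg_of_nonpos ha (by linarith))
        have h4 : -(a + b * c) ≤ -(c * R) := by
          refine le_of_pow_le_pow_left₀ two_ne_zero
            (neg_nonneg.2 (mul_nonpos_of_nonpos_of_nonneg hc0 hRpos.le)) ?_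
          rw [neg_sq, neg_sq]
          linarith
        linarith
  · rcases Real.sign_apply_eq ((1 - s) * r₀ - s * r₁) with h | h | h <;> rw [h] <;> norm_num

theorem interpRadius_zero_left {s r : ℝ} (hs : 0 ≤ s) (hr : 0 ≤ r) (L : ℝ) :
    interpRadius s 0 r L = s * r := by
  rw [interpRadius, show (1 - s) ^ 2 * (0 : ℝ) ^ 2 + s ^ 2 * r ^ 2
    + 2 * s * (1 - s) * 0 * r * cosPi L = (s * r) ^ 2 by ring]
  exact Real.sqrt_sq (mul_nonneg hs hr)

theorem interpRadius_zero_right {s r : ℝ} (hs : s ≤ 1) (hr : 0 ≤ r) (L : ℝ) :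
    interpRadius s r 0 L = (1 - s) * r := by
  rw [interpRadius, show (1 - s) ^ 2 * r ^ 2 + s ^ 2 * (0 : ℝ) ^ 2
    + 2 * s * (1 - s) * r * 0 * cosPi L = ((1 - s) * r) ^ 2 by ring]
  exact Real.sqrt_sq (mul_nonneg (sub_nonneg.2 hs) hr)

theorem interpWeight_zero_left {s r L : ℝ} (hs : 0 ≤ s) (hr : 0 ≤ r) (h : s * r ≠ 0)
    (hL : 0 < L) : interpWeight s 0 r L = 1 := by
  have hpos : 0 < s * r := lt_of_le_of_ne (mul_nonneg hs hr) (Ne.symm h)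
  rw [interpWeight, interpRadius_zero_left hs hr, if_neg h]
  split_ifs with hp
  · rw [mul_zero, zero_add, mul_div_cancel_left₀ _ h, Real.arccos_cos hL.le hp.le,
      one_div_mul_cancel hL.ne']
  · rw [Real.sign_of_neg (by linarith)]
    norm_num

theorem interpWeight_zero_right {s r L : ℝ} (hs : s ≤ 1) (hr : 0 ≤ r) (h : (1 - s) * r ≠ 0) :
    interpWeight s r 0 L = 0 := by
  have hpos : 0 < (1 - s) * r :=
    lt_of_le_of_ne (mul_nonneg (sub_nonneg.2 hs) hr) (Ne.symm h)
  rw [interpWeight, interpRadius_zero_right hs hr, if_neg h]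
  split_ifs with hp
  · rw [mul_zero, zero_mul, add_zero, div_self h, Real.arccos_one, mul_zero]
  · rw [Real.sign_of_pos (by linarith)]
    norm_num

/-- The base point `X = (1-ρ) x₀ + ρ x₁` of the interpolated point. -/
def interpPoint {d : ℕ} {Ω : Set (EuclideanSpace ℝ (Fin d))} (hΩ : Convex ℝ Ω) (s : I)
    (p q : Ω × ℝ≥0) : Ω :=
  ⟨(1 - interpWeight s p.2 q.2 (dist p.1 q.1)) • (p.1 : EuclideanSpace ℝ (Fin d))
      + interpWeight s p.2 q.2 (dist p.1 q.1) • (q.1 : EuclideanSpace ℝ (Fin d)),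
    have h := interpWeight_mem s.2 p.2.2 q.2.2 (dist_nonneg (x := p.1) (y := q.1))
    hΩ p.1.2 q.1.2 (sub_nonneg.2 h.2) h.1 (sub_add_cancel _ _)⟩

/-- The point `[X, R]` of the cone. -/
def interpAux {d : ℕ} {Ω : Set (EuclideanSpace ℝ (Fin d))} (hΩ : Convex ℝ Ω) (s : I)
    (p q : Ω × ℝ≥0) : Cone Ω :=
  Cone.mk (interpPoint hΩ s p q) ⟨interpRadius s p.2 q.2 (dist p.1 q.1), Real.sqrt_nonneg _⟩

theorem interpAux_zero_left {d : ℕ} {Ω : Set (EuclideanSpace ℝ (Fin d))} (hΩ : Convex ℝ Ω) (s : I)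
    (x : Ω) (q : Ω × ℝ≥0) :
    interpAux hΩ s (x, 0) q = Cone.mk q.1 ⟨s * q.2, mul_nonneg s.2.1 q.2.2⟩ := by
  have hR : (⟨interpRadius s ((0 : ℝ≥0) : ℝ) q.2 (dist x q.1), Real.sqrt_nonneg _⟩ : ℝ≥0)
      = ⟨s * q.2, mul_nonneg s.2.1 q.2.2⟩ :=
    Subtype.ext (interpRadius_zero_left s.2.1 q.2.2 _)
  rw [interpAux, hR]
  by_cases h : (s : ℝ) * q.2 = 0
  · rw [show (⟨s * q.2, mul_nonneg s.2.1 q.2.2⟩ : ℝ≥0) = 0 from Subtype.ext h]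
    exact Cone.mk_zero _ _
  · refine congrArg (fun u => Cone.mk u _) (Subtype.ext ?_)
    rcases (dist_nonneg (x := x) (y := q.1)).eq_or_lt with h0 | h0
    · obtain rfl : x = q.1 := dist_eq_zero.1 h0.symm
      simp only [interpPoint]
      rw [← add_smul, sub_add_cancel, one_smul]
    · have hw : interpWeight s ((0 : ℝ≥0) : ℝ) (q.2 : ℝ) (dist x q.1) = 1 :=
        interpWeight_zero_left s.2.1 q.2.2 h h0
      simp only [interpPoint]
      rw [hw, sub_self, zero_smul, zero_add, one_smul]

theorem interpAux_zero_right {d : ℕ} {Ω : Set (EuclideanSpace ℝ (Fin d))} (hΩ : Convex ℝ Ω)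
    (s : I) (p : Ω × ℝ≥0) (y : Ω) :
    interpAux hΩ s p (y, 0)
      = Cone.mk p.1 ⟨(1 - s) * p.2, mul_nonneg (sub_nonneg.2 s.2.2) p.2.2⟩ := by
  have hR : (⟨interpRadius s p.2 ((0 : ℝ≥0) : ℝ) (dist p.1 y), Real.sqrt_nonneg _⟩ : ℝ≥0)
      = ⟨(1 - s) * p.2, mul_nonneg (sub_nonneg.2 s.2.2) p.2.2⟩ :=
    Subtype.ext (interpRadius_zero_right s.2.2 p.2.2 _)
  rw [interpAux, hR]
  by_cases h : (1 - (s : ℝ)) * p.2 = 0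
  · rw [show (⟨(1 - s) * p.2, mul_nonneg (sub_nonneg.2 s.2.2) p.2.2⟩ : ℝ≥0) = 0
      from Subtype.ext h]
    exact Cone.mk_zero _ _
  · refine congrArg (fun u => Cone.mk u _) (Subtype.ext ?_)
    have hw : interpWeight s (p.2 : ℝ) ((0 : ℝ≥0) : ℝ) (dist p.1 y) = 0 :=
      interpWeight_zero_right s.2.2 p.2.2 h
    simp only [interpPoint]
    rw [hw, sub_zero, zero_smul, add_zero, one_smul]

/-- The geodesic interpolator `Z(s; z₀, z₁) = [X, R]` on the cone over a convex set `Ω`. -/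
def interp {d : ℕ} {Ω : Set (EuclideanSpace ℝ (Fin d))} (hΩ : Convex ℝ Ω) (s : I) :
    Cone Ω → Cone Ω → Cone Ω :=
  Quotient.lift₂ (interpAux hΩ s) (by
    have hl : ∀ p p' q : Ω × ℝ≥0, p.2 = 0 → p'.2 = 0 → interpAux hΩ s p q = interpAux hΩ s p' q := by
      rintro ⟨x, r⟩ ⟨x', r'⟩ q (rfl : r = 0) (rfl : r' = 0)
      rw [interpAux_zero_left, interpAux_zero_left]
    have hr : ∀ p q q' : Ω × ℝ≥0, q.2 = 0 → q'.2 = 0 → interpAux hΩ s p q = interpAux hΩ s p q' := by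
      rintro p ⟨x, r⟩ ⟨x', r'⟩ (rfl : r = 0) (rfl : r' = 0)
      rw [interpAux_zero_right, interpAux_zero_right]
    rintro p q p' q' (rfl | h) (rfl | h')
    · rfl
    · exact hr _ _ _ h'.1 h'.2
    · exact hl _ _ _ h.1 h.2
    · exact (hl _ _ _ h.1 h.2).trans (hr _ _ _ h'.1 h'.2))

/-- The curve `μ(s) = 𝔓 (Z(s; ·, ·)_# γ)`. -/
def curve {d : ℕ} {Ω : Set (EuclideanSpace ℝ (Fin d))} (hΩ : Convex ℝ Ω)
    (γ : Measure (Cone Ω × Cone Ω)) (s : I) : Measure Ω :=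
  proj (γ.map fun p => interp hΩ s p.1 p.2)

end HellingerKantorovich

end

noncomputable section

namespace HellingerKantorovich

/-! The curves `Z(·; z₀, z₁)` are Lipschitz in the cone with constant `d(z₀, z₁)`
(`dist_interp_le`). The joint image of `γ` under `Z(s)` and `Z(t)` is a plan between lifts of `μ(s)`
and `μ(t)`, and its cost is at most `|t-s|²` times that of `γ`. Hence `HK(μ(s), μ(t)) ≤ |t-s| HK(μ₀,
μ₁)` (`hk_curve_le`). Summing over `0 ≤ s ≤ t ≤ 1` and using the triangle inequality for `HK`, none
of these bounds can be strict; this needs `HK(μ₀, μ₁) < ∞`, which follows from `d(z₀, z₁) ≤ r₀ + r₁`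
and finite second moments.

The substantial point is the triangle inequality (`hk_triangle`): near-optimal plans for `(μ₀, μ₁)`
and `(μ₁, μ₂)` generally use different lifts of `μ₁` and cannot be glued directly. The remedy is
scaling: dividing both radii by `θ(z₀, z₁)` and multiplying the plan by `θ²` changes neither the
cost nor the projected marginals. With `θ` the radius of the middle point, the lift of `μ₁` becomes
`μ₁` placed at radius 1 plus an atom at the tip (`IsConePlan.exists_normalized`). Free mass at the
pair of tips equalizes the atoms (`IsConePlan.add_tip`); gluing and Minkowski in `L²` finish the
argument. -/

theorem continuous_cosPi : Continuous cosPi := by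
  unfold cosPi
  fun_prop

theorem coneDistAux_le_add {r₀ r₁ : ℝ} (h₀ : 0 ≤ r₀) (h₁ : 0 ≤ r₁) (L : ℝ) :
    coneDistAux r₀ r₁ L ≤ r₀ + r₁ := by
  refine Real.sqrt_le_iff.2 ⟨by positivity, ?_⟩
  nlinarith [mul_le_mul_of_nonneg_left (neg_one_le_cosPi L) (by positivity : 0 ≤ 2 * r₀ * r₁)]

/-! ### Topology and Borel structure of the cone -/

namespace Cone

theorem point_of_radius_eq_zero {X : Type*} {z w : Cone X} (hz : z.radius = 0)
    (hw : w.radius = 0) : z.point = w.point := by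
  rw [← mk_point_radius z, ← mk_point_radius w, hz, hw, mk_zero z.point w.point]

variable {X : Type*} [MetricSpace X]

theorem continuous_mk : Continuous fun p : X × ℝ≥0 => mk p.1 p.2 := by
  rw [continuous_iff_continuousAt]
  intro p
  rw [ContinuousAt, tendsto_iff_dist_tendsto_zero]
  have hc : Continuous fun q : X × ℝ≥0 => dist (mk q.1 q.2) (mk p.1 p.2) := by
    change Continuous fun q : X × ℝ≥0 => coneDistAux q.2 p.2 (dist q.1 p.1)
    have := continuous_cosPi
    unfold coneDistAux
    fun_prop
  simpa using hc.tendsto p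

theorem continuous_radius : Continuous (radius : Cone X → ℝ≥0) := by
  refine LipschitzWith.continuous (K := 1) (LipschitzWith.of_dist_le_mul fun z w => ?_)
  induction z using Cone.ind with | h x r => ?_
  induction w using Cone.ind with | h y s => ?_
  rw [NNReal.coe_one, one_mul]
  exact abs_sub_le_coneDistAux r.2 s.2 _

theorem measurable_radius : Measurable (radius : Cone X → ℝ≥0) := continuous_radius.measurable

instance [SecondCountableTopology X] : SecondCountableTopology (Cone X) := by
  have : TopologicalSpace.SeparableSpace (Cone X) :=
    (show Function.Surjective fun p : X × ℝ≥0 => mk p.1 p.2 from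
      fun z => ⟨(z.point, z.radius), mk_point_radius z⟩).denseRange.separableSpace continuous_mk
  exact UniformSpace.secondCountable_of_separable _

variable [MeasurableSpace X] [BorelSpace X] [StandardBorelSpace X] [SecondCountableTopology X]

/-- The Borel isomorphism between the cone and a measurable subset of `X × [0,∞)`. -/
theorem measurableEmbedding_point_radius :
    MeasurableEmbedding fun z : Cone X => (z.point, z.radius) := by
  have hinj : Function.Injective fun z : Cone X => (z.point, z.radius) := fun z w h => by
    simp only [Prod.mk.injEq] at h
    rw [← mk_point_radius z, ← mk_point_radius w, h.1, h.2]
  set T : Set (X × ℝ≥0) := Set.range fun z : Cone X => (z.point, z.radius) with hT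
  have hTm : MeasurableSet T := by
    -- The image is everything of positive radius and, at radius zero, only the arbitrary base point
    -- chosen for the tip.
    have : T = {p | p.2 ≠ 0} ∪ {p | (mk p.1 0).point = p.1 ∧ p.2 = 0} := by
      ext ⟨x, r⟩
      simp only [hT, Set.mem_range, Prod.mk.injEq, Set.mem_union, Set.mem_ofPred_eq]
      constructor
      · rintro ⟨z, rfl, rfl⟩
        by_cases h : z.radius = 0
        · exact Or.inr ⟨point_of_radius_eq_zero (radius_mk _ _) h, h⟩
        · exact Or.inl h
      · rintro (h | ⟨h, rfl⟩)
        · exact ⟨mk x r, point_mk x h, rfl⟩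
        · exact ⟨mk x 0, h, rfl⟩
    rw [this]
    refine MeasurableSet.union ?_ ?_
    · exact measurable_snd (measurableSet_singleton 0).compl
    · refine MeasurableSet.inter ?_ (measurable_snd (measurableSet_singleton 0))
      rcases isEmpty_or_nonempty X with h | ⟨⟨y⟩⟩
      · exact (Set.subsingleton_of_subsingleton).measurableSet
      · have : {p : X × ℝ≥0 | (mk p.1 0).point = p.1} = Prod.fst ⁻¹' {(mk y 0).point} := by
          ext p
          simp [mk_zero p.1 y, eq_comm]
        change MeasurableSet {p : X × ℝ≥0 | (mk p.1 0).point = p.1}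
        rw [this]
        exact measurable_fst (measurableSet_singleton _)
  have := hTm.standardBorel
  -- Lusin–Souslin: an injective Borel map out of the standard Borel space `T` has a Borel inverse,
  -- so continuity of `mk` suffices.
  have hg : MeasurableEmbedding fun p : T => mk p.1.1 p.1.2 := by
    refine (continuous_mk.measurable.comp measurable_subtype_coe).measurableEmbedding ?_
    rintro ⟨_, z, rfl⟩ ⟨_, w, rfl⟩ h
    simp only [Function.comp_apply, mk_point_radius] at h
    simp [h]
  have hsurj : Function.Surjective fun p : T => mk p.1.1 p.1.2 := fun z =>
    ⟨⟨_, z, rfl⟩, mk_point_radius z⟩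
  have hmeas : Measurable fun z : Cone X => (z.point, z.radius) := by
    intro S hS
    convert hg.measurableSet_image.2 (measurable_subtype_coe hS) using 1
    ext z
    constructor
    · intro hz
      exact ⟨⟨_, z, rfl⟩, hz, mk_point_radius z⟩
    · rintro ⟨⟨_, w, rfl⟩, hw, rfl⟩
      simpa only [Set.mem_preimage, mk_point_radius] using hw
  refine ⟨hinj, hmeas, fun {S} hS => ?_⟩
  convert (MeasurableEmbedding.subtype_coe hTm).measurableSet_image.2 (hg.measurable hS) using 1
  ext p
  constructor
  · rintro ⟨z, hz, rfl⟩
    exact ⟨⟨_, z, rfl⟩, by simpa only [Set.mem_preimage, mk_point_radius] using hz, rfl⟩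
  · rintro ⟨⟨_, w, rfl⟩, hw, rfl⟩
    exact ⟨w, by simpa only [Set.mem_preimage, mk_point_radius] using hw, rfl⟩

theorem measurable_point : Measurable (point : Cone X → X) :=
  measurableEmbedding_point_radius.measurable.fst

/-- Only the Borel sets matter: a Polish topology is pulled back from the measurable image in `X ×
[0,∞)`, and it need not be the metric topology of the cone. Disintegration of plans relies on this.
-/
instance : StandardBorelSpace (Cone X) := by
  have h := measurableEmbedding_point_radius (X := X)
  obtain ⟨t, _, _⟩ := h.measurableSet_range.standardBorel
  let e := h.equivRange
  exact ⟨t.induced e, @MeasurableEmbedding.borelSpace _ _ _ (t.induced e) _ _ _ e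
    e.measurableEmbedding (@Topology.IsInducing.mk _ _ (t.induced e) t e rfl),
    e.toEquiv.polishSpace_induced⟩

end Cone

/-! ### Planar geometry of the interpolator -/

theorem interpRadius_sq {s r₀ r₁ : ℝ} (hs : s ∈ Set.Icc (0 : ℝ) 1) (h₀ : 0 ≤ r₀) (h₁ : 0 ≤ r₁)
    (L : ℝ) : interpRadius s r₀ r₁ L ^ 2
      = (1 - s) ^ 2 * r₀ ^ 2 + s ^ 2 * r₁ ^ 2 + 2 * s * (1 - s) * r₀ * r₁ * cosPi L := by
  rw [interpRadius, Real.sq_sqrt]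
  have ha : 0 ≤ (1 - s) * r₀ := mul_nonneg (sub_nonneg.2 hs.2) h₀
  have hb : 0 ≤ s * r₁ := mul_nonneg hs.1 h₁
  have := mul_le_mul_of_nonneg_left (neg_one_le_cosPi L) (mul_nonneg ha hb)
  nlinarith [sq_nonneg ((1 - s) * r₀ - s * r₁)]

theorem interpRadius_le {s r₀ r₁ : ℝ} (hs : s ∈ Set.Icc (0 : ℝ) 1) (h₀ : 0 ≤ r₀) (h₁ : 0 ≤ r₁)
    (L : ℝ) : interpRadius s r₀ r₁ L ≤ r₀ + r₁ := by
  have ha : 0 ≤ (1 - s) * r₀ := mul_nonneg (sub_nonneg.2 hs.2) h₀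
  have hb : 0 ≤ s * r₁ := mul_nonneg hs.1 h₁
  have h : interpRadius s r₀ r₁ L ≤ (1 - s) * r₀ + s * r₁ := by
    refine Real.sqrt_le_iff.2 ⟨by positivity, ?_⟩
    have := mul_le_mul_of_nonneg_left (cosPi_le_one L) (mul_nonneg ha hb)
    nlinarith
  nlinarith [hs.1, hs.2]

/-- In polar coordinates, the interpolated point lies on the segment from `r₀` to
`r₁ exp(i L)`. -/
theorem interpRadius_mul_exp {s r₀ r₁ L : ℝ} (hs : s ∈ Set.Icc (0 : ℝ) 1) (h₀ : 0 ≤ r₀)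
    (h₁ : 0 ≤ r₁) (hL : 0 ≤ L) (hLp : L < Real.pi) :
    (interpRadius s r₀ r₁ L : ℂ)
        * Complex.exp ((interpWeight s r₀ r₁ L * L : ℝ) * Complex.I)
      = (1 - s : ℝ) * r₀ + (s : ℝ) * (r₁ * Complex.exp ((L : ℝ) * Complex.I)) := by
  have hsq := interpRadius_sq hs h₀ h₁ L
  rw [cosPi_of_le hL hLp.le] at hsq
  have hR0 : 0 ≤ interpRadius s r₀ r₁ L := Real.sqrt_nonneg _
  have hpyth := Real.sin_sq_add_cos_sq L
  have hsin : 0 ≤ Real.sin L := Real.sin_nonneg_of_nonneg_of_le_pi hL hLp.le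
  have hb : 0 ≤ s * r₁ * Real.sin L := mul_nonneg (mul_nonneg hs.1 h₁) hsin
  have hsum : ((1 - s) * r₀ + s * r₁ * Real.cos L) ^ 2 + (s * r₁ * Real.sin L) ^ 2
      = interpRadius s r₀ r₁ L ^ 2 := by
    rw [hsq]; linear_combination (s * r₁) ^ 2 * hpyth
  have key : interpRadius s r₀ r₁ L * Real.cos (interpWeight s r₀ r₁ L * L)
        = (1 - s) * r₀ + s * r₁ * Real.cos L ∧
      interpRadius s r₀ r₁ L * Real.sin (interpWeight s r₀ r₁ L * L) = s * r₁ * Real.sin L := by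
    by_cases hR : interpRadius s r₀ r₁ L = 0
    · rw [hR] at hsum ⊢
      constructor <;> nlinarith [sq_nonneg ((1 - s) * r₀ + s * r₁ * Real.cos L),
        sq_nonneg (s * r₁ * Real.sin L)]
    have hRpos : 0 < interpRadius s r₀ r₁ L := lt_of_le_of_ne hR0 (Ne.symm hR)
    have hw : interpWeight s r₀ r₁ L * L = Real.arccos
        (((1 - s) * r₀ + s * r₁ * Real.cos L) / interpRadius s r₀ r₁ L) := by
      rw [interpWeight, if_neg hR, if_pos hLp]
      -- At `L = 0` the weight is `1 / 0 * _ = 0`; this is consistent because the quotient inside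
      -- `arccos` is then 1.
      rcases hL.eq_or_lt with rfl | hpos
      · have : interpRadius s r₀ r₁ 0 = (1 - s) * r₀ + s * r₁ := by
          refine (sq_eq_sq₀ hR0 (add_nonneg (mul_nonneg (sub_nonneg.2 hs.2) h₀)
            (mul_nonneg hs.1 h₁))).1 ?_
          rw [← hsum]; simp
        rw [Real.cos_zero, mul_one, ← this, div_self hR, Real.arccos_one, mul_zero]
      · field_simp
    have hle : |((1 - s) * r₀ + s * r₁ * Real.cos L)| ≤ interpRadius s r₀ r₁ L :=
      abs_le_of_sq_le_sq (by nlinarith) hR0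
    have hle' := abs_le.1 hle
    have hcos := Real.cos_arccos
      (x := ((1 - s) * r₀ + s * r₁ * Real.cos L) / interpRadius s r₀ r₁ L)
      (by rw [le_div_iff₀ hRpos]; linarith) (by rw [div_le_iff₀ hRpos]; linarith)
    rw [hw]
    refine ⟨by rw [hcos]; field_simp, ?_⟩
    -- Comparing squares is legitimate because `sin L ≥ 0` on `[0, π]`, which fixes the sign of the
    -- imaginary part.
    rw [Real.sin_arccos, ← sq_eq_sq₀ (by positivity) hb, mul_pow, Real.sq_sqrt]
    · field_simp; linarith
    · rw [div_pow, sub_nonneg, div_le_one (by positivity)]; nlinarith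
  apply Complex.ext
  · simp only [Complex.re_ofReal_mul, Complex.add_re, Complex.exp_ofReal_mul_I_re,
      Complex.ofReal_re]
    linarith [key.1]
  · simp only [Complex.im_ofReal_mul, Complex.add_im, Complex.exp_ofReal_mul_I_im,
      Complex.ofReal_im]
    linarith [key.2]

theorem interpRadius_of_pi_le {s r₀ r₁ L : ℝ} (h : Real.pi ≤ L) :
    interpRadius s r₀ r₁ L = |(1 - s) * r₀ - s * r₁| := by
  rw [interpRadius, cosPi_of_ge h, ← Real.sqrt_sq_eq_abs]
  congr 1
  ring

theorem interpWeight_of_pi_le {s r₀ r₁ L : ℝ} (h : Real.pi ≤ L) :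
    (0 < (1 - s) * r₀ - s * r₁ → interpWeight s r₀ r₁ L = 0) ∧
      ((1 - s) * r₀ - s * r₁ < 0 → interpWeight s r₀ r₁ L = 1) := by
  rw [interpWeight, interpRadius_of_pi_le h, if_neg h.not_gt]
  constructor <;> intro ha
  · rw [if_neg (abs_ne_zero.2 ha.ne'), Real.sign_of_pos ha]; norm_num
  · rw [if_neg (abs_ne_zero.2 ha.ne), Real.sign_of_neg ha]; norm_num

theorem coneDistAux_self_zero (r₀ r₁ : ℝ) : coneDistAux r₀ r₁ 0 = |r₀ - r₁| := by
  rw [coneDistAux, cosPi_of_le le_rfl Real.pi_pos.le, Real.cos_zero, ← Real.sqrt_sq_eq_abs]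
  congr 1
  ring

/-- For `L < π` the two points lie on a chord of a planar sector of angle `L`, where the cone
distance is Euclidean. For `L ≥ π` the geodesic runs through the tip: it is a segment of the real
line with signed coordinate `(1-s) r₀ - s r₁`, the sign selecting the ray. -/
theorem coneDistAux_interp_le {s t r₀ r₁ L : ℝ} (hs : s ∈ Set.Icc (0 : ℝ) 1)
    (ht : t ∈ Set.Icc (0 : ℝ) 1) (h₀ : 0 ≤ r₀) (h₁ : 0 ≤ r₁) (hL : 0 ≤ L) :
    coneDistAux (interpRadius s r₀ r₁ L) (interpRadius t r₀ r₁ L)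
        |interpWeight s r₀ r₁ L * L - interpWeight t r₀ r₁ L * L|
      ≤ |t - s| * coneDistAux r₀ r₁ L := by
  rcases lt_or_ge L Real.pi with hp | hp
  · have hsm := interpWeight_mem hs h₀ h₁ hL
    have htm := interpWeight_mem ht h₀ h₁ hL
    -- Both weights lie in `[0, 1]`, so the angle between the points stays below the truncation of
    -- `cosPi`.
    have hle : |interpWeight s r₀ r₁ L * L - interpWeight t r₀ r₁ L * L| ≤ Real.pi := by
      rw [← sub_mul, abs_mul, abs_of_nonneg hL]
      have : |interpWeight s r₀ r₁ L - interpWeight t r₀ r₁ L| ≤ 1 :=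
        abs_le.2 ⟨by linarith [hsm.1, htm.2], by linarith [hsm.2, htm.1]⟩
      nlinarith
    rw [coneDistAux, cosPi_of_le (abs_nonneg _) hle, Real.cos_abs, ← norm_polar_sub,
      interpRadius_mul_exp hs h₀ h₁ hL hp, interpRadius_mul_exp ht h₀ h₁ hL hp]
    have e : (((1 - s : ℝ) * r₀ + (s : ℝ) * (r₁ * Complex.exp ((L : ℝ) * Complex.I)))
        - ((1 - t : ℝ) * r₀ + (t : ℝ) * (r₁ * Complex.exp ((L : ℝ) * Complex.I))) : ℂ)
        = ((t - s : ℝ) : ℂ) * ((r₀ : ℂ) * Complex.exp ((0 : ℝ) * Complex.I)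
          - r₁ * Complex.exp ((L : ℝ) * Complex.I)) := by
      push_cast
      rw [zero_mul, Complex.exp_zero]
      ring
    rw [e, norm_mul, norm_polar_sub, Complex.norm_real, Real.norm_eq_abs, zero_sub, Real.cos_neg,
      coneDistAux, cosPi_of_le hL hp.le]
  · have hs' := interpWeight_of_pi_le (s := s) (r₀ := r₀) (r₁ := r₁) hp
    have ht' := interpWeight_of_pi_le (s := t) (r₀ := r₀) (r₁ := r₁) hp
    have hab : |((1 - s) * r₀ - s * r₁) - ((1 - t) * r₀ - t * r₁)|
        = |t - s| * (r₀ + r₁) := by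
      nth_rewrite 1 [← abs_of_nonneg (add_nonneg h₀ h₁)]
      rw [← abs_mul]
      congr 1
      ring
    rw [coneDistAux_of_ge h₀ h₁ hp, interpRadius_of_pi_le hp, interpRadius_of_pi_le hp, ← hab]
    generalize (1 - s) * r₀ - s * r₁ = a at *
    generalize (1 - t) * r₀ - t * r₁ = b at *
    have hsum := coneDistAux_le_add (abs_nonneg a) (abs_nonneg b)
      |interpWeight s r₀ r₁ L * L - interpWeight t r₀ r₁ L * L|
    -- Equal signs: same base point, so the distance is the difference of radii. Opposite signs, or
    -- one point at the tip: the path through the tip has length `|a| + |b| = |a - b|`.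
    rcases lt_trichotomy a 0 with ha | rfl | ha <;> rcases lt_trichotomy b 0 with hb | rfl | hb
    · rw [hs'.2 ha, ht'.2 hb, sub_self, abs_zero, coneDistAux_self_zero, abs_of_neg ha,
        abs_of_neg hb, neg_sub_neg, abs_sub_comm]
    · simpa using hsum
    · refine hsum.trans ?_
      rw [abs_of_neg ha, abs_of_pos hb, abs_of_neg (by linarith)]; linarith
    · simpa using hsum
    · simpa using hsum
    · simpa using hsum
    · refine hsum.trans ?_
      rw [abs_of_pos ha, abs_of_neg hb, abs_of_pos (by linarith)]; linarith
    · simpa using hsum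
    · rw [hs'.1 ha, ht'.1 hb, sub_self, abs_zero, coneDistAux_self_zero, abs_of_pos ha,
        abs_of_pos hb]

/-! ### The interpolator on the cone over a convex set -/

section Interp

variable {d : ℕ} {Ω : Set (EuclideanSpace ℝ (Fin d))} (hΩ : Convex ℝ Ω)

theorem interp_mk (s : I) (x y : Ω) (r₀ r₁ : ℝ≥0) :
    interp hΩ s (Cone.mk x r₀) (Cone.mk y r₁) = interpAux hΩ s (x, r₀) (y, r₁) := rfl

theorem dist_interpPoint (s t : I) (p q : Ω × ℝ≥0) :
    dist (interpPoint hΩ s p q) (interpPoint hΩ t p q)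
      = |interpWeight s p.2 q.2 (dist p.1 q.1) * dist p.1 q.1
          - interpWeight t p.2 q.2 (dist p.1 q.1) * dist p.1 q.1| := by
  rw [Subtype.dist_eq, ← sub_mul, abs_mul, abs_of_nonneg (dist_nonneg (x := p.1) (y := q.1))]
  simp only [interpPoint]
  generalize interpWeight s p.2 q.2 (dist p.1 q.1) = a
  generalize interpWeight t p.2 q.2 (dist p.1 q.1) = b
  rw [dist_comm p.1 q.1, dist_eq_norm, Subtype.dist_eq, dist_eq_norm, ← Real.norm_eq_abs,
    ← norm_smul]
  congr 1
  module

theorem dist_interp_le (s t : I) (z w : Cone Ω) :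
    dist (interp hΩ s z w) (interp hΩ t z w) ≤ |(t : ℝ) - s| * dist z w := by
  induction z using Cone.ind with | h x r => ?_
  induction w using Cone.ind with | h y r' => ?_
  rw [interp_mk, interp_mk]
  change coneDistAux (interpRadius s r r' (dist x y)) (interpRadius t r r' (dist x y))
    (dist (interpPoint hΩ s (x, r) (y, r')) (interpPoint hΩ t (x, r) (y, r'))) ≤
    |(t : ℝ) - s| * coneDistAux r r' (dist x y)
  rw [dist_interpPoint]
  exact coneDistAux_interp_le s.2 t.2 r.2 r'.2 dist_nonneg

theorem interp_zero (z w : Cone Ω) : interp hΩ 0 z w = z := by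
  induction z using Cone.ind with | h x r => ?_
  induction w using Cone.ind with | h y r' => ?_
  rw [interp_mk, interpAux]
  have hR : interpRadius (0 : ℝ) r r' (dist x y) = r := by simp [interpRadius]
  have hR' : (⟨interpRadius ((0 : I) : ℝ) r r' (dist x y), Real.sqrt_nonneg _⟩ : ℝ≥0) = r :=
    Subtype.ext hR
  simp only at hR' ⊢
  rw [hR']
  by_cases h : r = 0
  · rw [h]; exact Cone.mk_zero _ _
  refine congrArg (fun u => Cone.mk u r) (Subtype.ext ?_)
  have h' : (0 : ℝ) < r := NNReal.coe_pos.2 (pos_iff_ne_zero.2 h)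
  have hw : interpWeight ((0 : I) : ℝ) r r' (dist x y) = 0 := by
    rw [Set.Icc.coe_zero, interpWeight, hR, if_neg h'.ne']
    split_ifs with hp
    · simp [h'.ne']
    · simp [Real.sign_of_pos h']
  simp only [interpPoint, hw, sub_zero, one_smul, zero_smul, add_zero]

theorem interp_one (z w : Cone Ω) : interp hΩ 1 z w = w := by
  induction z using Cone.ind with | h x r => ?_
  induction w using Cone.ind with | h y r' => ?_
  rw [interp_mk, interpAux]
  have hR : interpRadius (1 : ℝ) r r' (dist x y) = r' := by simp [interpRadius]
  have hR' : (⟨interpRadius ((1 : I) : ℝ) r r' (dist x y), Real.sqrt_nonneg _⟩ : ℝ≥0) = r' :=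
    Subtype.ext hR
  simp only at hR' ⊢
  rw [hR']
  by_cases h : r' = 0
  · rw [h]; exact Cone.mk_zero _ _
  refine congrArg (fun u => Cone.mk u r') (Subtype.ext ?_)
  have h' : (0 : ℝ) < r' := NNReal.coe_pos.2 (pos_iff_ne_zero.2 h)
  -- For `x = y` the weight defaults to 0 rather than 1, but the convex combination is the same
  -- point.
  rcases (dist_nonneg (x := x) (y := y)).eq_or_lt with h0 | h0
  · obtain rfl : x = y := dist_eq_zero.1 h0.symm
    simp only [interpPoint]
    rw [← add_smul, sub_add_cancel, one_smul]
  have hw : interpWeight ((1 : I) : ℝ) r r' (dist x y) = 1 := by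
    rw [Set.Icc.coe_one, interpWeight, hR, if_neg h'.ne']
    split_ifs with hp
    · rw [sub_self, zero_mul, zero_add, one_mul, mul_div_cancel_left₀ _ h'.ne',
        Real.arccos_cos h0.le hp.le, one_div_mul_cancel h0.ne']
    · rw [Real.sign_of_neg (by linarith)]
      norm_num
  simp only [interpPoint, hw, sub_self, one_smul, zero_smul, zero_add]

theorem radius_interp_le (s : I) (z w : Cone Ω) :
    (interp hΩ s z w).radius ≤ z.radius + w.radius := by
  induction z using Cone.ind with | h x r => ?_
  induction w using Cone.ind with | h y r' => ?_
  exact interpRadius_le s.2 r.2 r'.2 _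

theorem measurable_realSign : Measurable Real.sign := by
  unfold Real.sign
  exact Measurable.ite measurableSet_Iio measurable_const
    (Measurable.ite measurableSet_Ioi measurable_const measurable_const)

theorem measurable_interpRadius (s : ℝ) :
    Measurable fun p : ℝ × ℝ × ℝ => interpRadius s p.1 p.2.1 p.2.2 := by
  have := continuous_cosPi.measurable
  unfold interpRadius
  fun_prop

theorem measurable_interpWeight (s : ℝ) :
    Measurable fun p : ℝ × ℝ × ℝ => interpWeight s p.1 p.2.1 p.2.2 := by
  have h1 := measurable_interpRadius s
  have h2 := measurable_realSign
  have h3 : Measurable Real.arccos := Real.continuous_arccos.measurable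
  unfold interpWeight
  refine Measurable.ite (h1 (measurableSet_singleton 0)) measurable_const
    (Measurable.ite (measurableSet_lt (by fun_prop) measurable_const) ?_ (by fun_prop))
  fun_prop

/-- In the Borel coordinates `point` and `radius` the interpolator is an explicit formula; the
arbitrary base point at the tip is harmless because `interp` respects the quotient. -/
theorem measurable_interp (hΩ_closed : IsClosed Ω) (s : I) :
    Measurable fun p : Cone Ω × Cone Ω => interp hΩ s p.1 p.2 := by
  have : StandardBorelSpace Ω := hΩ_closed.measurableSet.standardBorel
  have e : (fun p : Cone Ω × Cone Ω => interp hΩ s p.1 p.2)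
      = fun p => interpAux hΩ s (p.1.point, p.1.radius) (p.2.point, p.2.radius) := by
    funext p
    rw [← interp_mk, Cone.mk_point_radius, Cone.mk_point_radius]
  have hp := Cone.measurable_point (X := Ω)
  have hr := Cone.measurable_radius (X := Ω)
  have harg : Measurable fun p : Cone Ω × Cone Ω =>
      ((p.1.radius : ℝ), (p.2.radius : ℝ), dist p.1.point p.2.point) :=
    (hr.comp measurable_fst).coe_nnreal_real.prodMk
      ((hr.comp measurable_snd).coe_nnreal_real.prodMk
        ((hp.comp measurable_fst).dist (hp.comp measurable_snd)))
  have hw := (measurable_interpWeight s).comp harg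
  have hR := (measurable_interpRadius s).comp harg
  have hx : Measurable fun p : Cone Ω × Cone Ω => (p.1.point : EuclideanSpace ℝ (Fin d)) :=
    measurable_subtype_coe.comp (hp.comp measurable_fst)
  have hy : Measurable fun p : Cone Ω × Cone Ω => (p.2.point : EuclideanSpace ℝ (Fin d)) :=
    measurable_subtype_coe.comp (hp.comp measurable_snd)
  rw [e]
  refine Cone.continuous_mk.measurable.comp (Measurable.prodMk ?_ ?_)
  · exact (((measurable_const.sub hw).smul hx).add (hw.smul hy)).subtype_mk
  · exact hR.subtype_mk

end Interp

/-! ### Gluing of measures -/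

open ProbabilityTheory in
/-- Two finite measures with a common marginal can be glued along it. -/
theorem exists_glue {A B C : Type*} [MeasurableSpace A] [MeasurableSpace B] [MeasurableSpace C]
    [StandardBorelSpace A] [StandardBorelSpace C] [Nonempty A] [Nonempty C]
    (α : Measure (A × B)) (β : Measure (B × C)) [IsFiniteMeasure α] [IsFiniteMeasure β]
    (h : α.map Prod.snd = β.map Prod.fst) :
    ∃ Γ : Measure (B × A × C), Γ.map (fun p => (p.2.1, p.1)) = α ∧
      Γ.map (fun p => (p.1, p.2.2)) = β := by
  have hfst : (α.map Prod.swap).fst = β.fst := by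
    rw [Measure.fst, Measure.fst, ← h, Measure.map_map measurable_fst measurable_swap]
    rfl
  -- The outer coordinates are taken conditionally independent given the shared one.
  refine ⟨β.fst ⊗ₘ ((α.map Prod.swap).condKernel ×ₖ β.condKernel), ?_, ?_⟩
  · have e : (fun p : B × A × C => (p.2.1, p.1)) = Prod.swap ∘ Prod.map id Prod.fst := rfl
    rw [e, ← Measure.map_map (by fun_prop) (by fun_prop), ← Measure.compProd_map measurable_fst,
      ← Kernel.fst_eq, Kernel.fst_prod, ← hfst, Measure.disintegrate,
      Measure.map_map (by fun_prop) (by fun_prop)]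
    simp
  · have e : (fun p : B × A × C => (p.1, p.2.2)) = Prod.map id Prod.snd := rfl
    rw [e, ← Measure.compProd_map measurable_snd, ← Kernel.snd_eq, Kernel.snd_prod,
      Measure.disintegrate]

/-! ### Dilations of the cone -/

namespace Cone

variable {X : Type*}

/-- The dilation `[x, r] ↦ [x, c r]` of the cone. -/
def dilation (c : ℝ≥0) (z : Cone X) : Cone X := mk z.point (c * z.radius)

theorem dilation_mk (c : ℝ≥0) (x : X) (r : ℝ≥0) : dilation c (mk x r) = mk x (c * r) := by
  rw [dilation, radius_mk]
  by_cases h : r = 0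
  · rw [h, mul_zero]; exact mk_zero _ _
  · rw [point_mk x h]

theorem radius_dilation (c : ℝ≥0) (z : Cone X) : (dilation c z).radius = c * z.radius := rfl

theorem point_dilation {c : ℝ≥0} {z : Cone X} (hc : c ≠ 0) (hz : z.radius ≠ 0) :
    (dilation c z).point = z.point := point_mk _ (mul_ne_zero hc hz)

theorem edist_dilation [MetricSpace X] (c : ℝ≥0) (z w : Cone X) :
    edist (dilation c z) (dilation c w) = c * edist z w := by
  have h : dist (dilation c z) (dilation c w) = c * dist z w := by
    induction z using Cone.ind with | h x r => ?_
    induction w using Cone.ind with | h y s => ?_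
    rw [dilation_mk, dilation_mk]
    change coneDistAux ((c * r : ℝ≥0) : ℝ) ((c * s : ℝ≥0) : ℝ) (dist x y)
      = c * coneDistAux r s (dist x y)
    rw [coneDistAux, coneDistAux, NNReal.coe_mul, NNReal.coe_mul,
      ← Real.sqrt_sq c.coe_nonneg, ← Real.sqrt_mul (sq_nonneg _), Real.sqrt_sq c.coe_nonneg]
    congr 1
    ring
  rw [edist_dist, edist_dist, h, ENNReal.ofReal_mul c.coe_nonneg, ENNReal.ofReal_coe_nnreal]

theorem dist_le_radius_add_radius [MetricSpace X] (z w : Cone X) :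
    dist z w ≤ z.radius + w.radius := by
  induction z using Cone.ind with | h x r => ?_
  induction w using Cone.ind with | h y s => ?_
  exact coneDistAux_le_add r.2 s.2 _

theorem edist_le_radius_add_radius [MetricSpace X] (z w : Cone X) :
    edist z w ≤ (z.radius + w.radius : ℝ≥0) := by
  rw [edist_dist]
  exact (ENNReal.ofReal_le_ofReal (dist_le_radius_add_radius z w)).trans
    (ENNReal.ofReal_coe_nnreal (p := z.radius + w.radius)).le

end Cone

theorem sq_mul_inv_mul_sq {c : ℝ≥0} (hc : c ≠ 0) (a : ℝ≥0∞) :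
    (c : ℝ≥0∞) ^ 2 * (((c⁻¹ : ℝ≥0) : ℝ≥0∞) * a) ^ 2 = a ^ 2 := by
  rw [← mul_pow, ← mul_assoc, ← ENNReal.coe_mul, mul_inv_cancel₀ hc, ENNReal.coe_one, one_mul]

/-- The integrand defining `proj` is 2-homogeneous in the radius. A dilation keeps the base point
off the tip, and at the tip the weight is zero. -/
theorem sq_mul_radius_dilation {X : Type*} {c : ℝ≥0} (hc : c ≠ 0) (z : Cone X) (φ : X → ℝ≥0∞) :
    (c : ℝ≥0∞) ^ 2 * (((Cone.dilation c⁻¹ z).radius : ℝ≥0∞) ^ 2 * φ (Cone.dilation c⁻¹ z).point)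
      = (z.radius : ℝ≥0∞) ^ 2 * φ z.point := by
  rw [← mul_assoc, Cone.radius_dilation, ENNReal.coe_mul, sq_mul_inv_mul_sq hc]
  by_cases hz : z.radius = 0
  · simp [hz]
  · rw [Cone.point_dilation (inv_ne_zero hc) hz]

theorem measurable_edist_sq {X : Type*} [MetricSpace X] [SecondCountableTopology X] :
    Measurable fun p : Cone X × Cone X => edist p.1 p.2 ^ 2 :=
  measurable_edist.pow_const 2

theorem planCost_swap {X : Type*} [MetricSpace X] [SecondCountableTopology X]
    (γ : Measure (Cone X × Cone X)) : planCost (γ.map Prod.swap) = planCost γ := by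
  rw [planCost, lintegral_map measurable_edist_sq measurable_swap]
  simp [planCost, edist_comm]

/-! ### `HK` as an infimum over plans -/

variable {X : Type*} [MetricSpace X] [MeasurableSpace X]

/-- `γ` is a finite plan on the cone whose marginals are lifts of the finite measures `μ` and
`ν`. -/
structure IsConePlan (γ : Measure (Cone X × Cone X)) (μ ν : Measure X) : Prop where
  finite : IsFiniteMeasure γ
  finite_left : IsFiniteMeasure μ
  finite_right : IsFiniteMeasure ν
  proj_fst : proj (γ.map Prod.fst) = μ
  proj_snd : proj (γ.map Prod.snd) = ν

theorem IsConePlan.swap {γ : Measure (Cone X × Cone X)} {μ ν : Measure X}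
    (h : IsConePlan γ μ ν) : IsConePlan (γ.map Prod.swap) ν μ := by
  obtain ⟨_, _, _, rfl, rfl⟩ := h
  refine ⟨inferInstance, inferInstance, inferInstance, ?_, ?_⟩
  · rw [Measure.map_map measurable_fst measurable_swap]; rfl
  · rw [Measure.map_map measurable_snd measurable_swap]; rfl

variable [BorelSpace X] [StandardBorelSpace X] [SecondCountableTopology X]

theorem lintegral_proj (l : Measure (Cone X)) {φ : X → ℝ≥0∞} (hφ : Measurable φ) :
    ∫⁻ x, φ x ∂(proj l) = ∫⁻ z, (z.radius : ℝ≥0∞) ^ 2 * φ z.point ∂l := by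
  rw [proj, lintegral_map hφ Cone.measurable_point]
  exact lintegral_withDensity_eq_lintegral_mul _
    (Cone.measurable_radius.coe_nnreal_ennreal.pow_const 2) (hφ.comp Cone.measurable_point)

theorem proj_univ (l : Measure (Cone X)) :
    proj l Set.univ = ∫⁻ z, (z.radius : ℝ≥0∞) ^ 2 ∂l := by
  rw [← lintegral_one, lintegral_proj l measurable_const]
  simp

theorem isFiniteMeasure_proj_iff {l : Measure (Cone X)} :
    IsFiniteMeasure (proj l) ↔ ∫⁻ z, (z.radius : ℝ≥0∞) ^ 2 ∂l < ∞ := by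
  rw [isFiniteMeasure_iff, proj_univ]

/-- The marginals of the plan serve as the lifts; their second moments are the total masses of `μ`
and `ν`, hence finite. With the converse below, the nested infima collapse to one over plans. -/
theorem hk_le_of_isConePlan {γ : Measure (Cone X × Cone X)} {μ ν : Measure X}
    (h : IsConePlan γ μ ν) : hk μ ν ≤ planCost γ ^ (1 / 2 : ℝ) := by
  obtain ⟨_, _, _, rfl, rfl⟩ := h
  refine (iInf₂_le_of_le (γ.map Prod.fst) (γ.map Prod.snd) (iInf₂_le_of_le
    ⟨⟨inferInstance, isFiniteMeasure_proj_iff.1 inferInstance⟩, rfl⟩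
    ⟨⟨inferInstance, isFiniteMeasure_proj_iff.1 inferInstance⟩, rfl⟩ ?_))
  exact ENNReal.rpow_le_rpow (iInf₂_le γ ⟨inferInstance, rfl, rfl⟩) (by norm_num)

theorem exists_isConePlan_of_hk_lt {μ ν : Measure X} {c : ℝ≥0∞} (h : hk μ ν < c) :
    ∃ γ, IsConePlan γ μ ν ∧ planCost γ ^ (1 / 2 : ℝ) < c := by
  simp only [hk, iInf_lt_iff] at h
  obtain ⟨l₀, l₁, ⟨h₀, rfl⟩, ⟨h₁, rfl⟩, h⟩ := h
  have h' : (⨅ (γ : Measure (Cone X × Cone X)) (_ : IsPlan γ l₀ l₁), planCost γ)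
      < c ^ (2 : ℝ) := by
    rw [wass] at h
    have := ENNReal.rpow_lt_rpow h (by norm_num : (0 : ℝ) < 2)
    rwa [← ENNReal.rpow_mul, one_div, inv_mul_cancel₀ two_ne_zero, ENNReal.rpow_one] at this
  simp only [iInf_lt_iff] at h'
  obtain ⟨γ, ⟨hf, rfl, rfl⟩, hγ⟩ := h'
  refine ⟨γ, ⟨hf, isFiniteMeasure_proj_iff.2 h₀.moment, isFiniteMeasure_proj_iff.2 h₁.moment,
    rfl, rfl⟩, ?_⟩
  have := ENNReal.rpow_lt_rpow hγ (by norm_num : (0 : ℝ) < 1 / 2)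
  rwa [← ENNReal.rpow_mul, mul_one_div_cancel two_ne_zero, ENNReal.rpow_one] at this

theorem hk_comm (μ ν : Measure X) : hk μ ν = hk ν μ := by
  have key : ∀ μ ν : Measure X, hk μ ν ≤ hk ν μ := fun μ ν =>
    le_of_forall_gt_imp_ge_of_dense fun c hc => by
      obtain ⟨γ, hγ, hlt⟩ := exists_isConePlan_of_hk_lt hc
      have := hk_le_of_isConePlan hγ.swap
      rw [planCost_swap] at this
      exact this.trans hlt.le
  exact le_antisymm (key _ _) (key _ _)

/-! ### Scaling invariance and normalized plans -/

/-- The plan `(z, w) ↦ (z/θ, w/θ)` applied to `θ² γ`. -/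
def dilatedPlan (γ : Measure (Cone X × Cone X)) (θ : Cone X × Cone X → ℝ≥0) :
    Measure (Cone X × Cone X) :=
  (γ.withDensity fun p => (θ p : ℝ≥0∞) ^ 2).map fun p =>
    (Cone.dilation (θ p)⁻¹ p.1, Cone.dilation (θ p)⁻¹ p.2)

section Dilation

variable {γ : Measure (Cone X × Cone X)} {θ : Cone X × Cone X → ℝ≥0}

theorem measurable_dilation {Y : Type*} [MeasurableSpace Y] {c : Y → ℝ≥0} {f : Y → Cone X}
    (hc : Measurable c) (hf : Measurable f) : Measurable fun y => Cone.dilation (c y) (f y) :=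
  Cone.continuous_mk.measurable.comp
    ((Cone.measurable_point.comp hf).prodMk (hc.mul (Cone.measurable_radius.comp hf)))

theorem lintegral_dilatedPlan (hθ : Measurable θ) {F : Cone X × Cone X → ℝ≥0∞}
    (hF : Measurable F) : ∫⁻ p, F p ∂(dilatedPlan γ θ)
      = ∫⁻ p, (θ p : ℝ≥0∞) ^ 2 *
          F (Cone.dilation (θ p)⁻¹ p.1, Cone.dilation (θ p)⁻¹ p.2) ∂γ := by
  have hm : Measurable fun p : Cone X × Cone X =>
      (Cone.dilation (θ p)⁻¹ p.1, Cone.dilation (θ p)⁻¹ p.2) :=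
    (measurable_dilation hθ.inv measurable_fst).prodMk (measurable_dilation hθ.inv measurable_snd)
  rw [dilatedPlan, lintegral_map hF hm]
  exact lintegral_withDensity_eq_lintegral_mul _ (hθ.coe_nnreal_ennreal.pow_const 2)
    (hF.comp hm)

/-- The squared cone distance is 2-homogeneous under a common dilation, so the weight `θ²` cancels
pointwise. -/
theorem planCost_dilatedPlan (hθ : Measurable θ) (h0 : ∀ p, θ p ≠ 0) :
    planCost (dilatedPlan γ θ) = planCost γ := by
  rw [planCost, lintegral_dilatedPlan hθ measurable_edist_sq, planCost]
  simp only [Cone.edist_dilation, sq_mul_inv_mul_sq (h0 _)]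

theorem proj_map_dilatedPlan (hθ : Measurable θ) (h0 : ∀ p, θ p ≠ 0) :
    proj ((dilatedPlan γ θ).map Prod.fst) = proj (γ.map Prod.fst) ∧
      proj ((dilatedPlan γ θ).map Prod.snd) = proj (γ.map Prod.snd) := by
  have hr := Cone.measurable_radius (X := X)
  have hp := Cone.measurable_point (X := X)
  constructor <;> refine Measure.ext_of_lintegral _ fun φ hφ => ?_ <;>
    have hm : Measurable fun z : Cone X => (z.radius : ℝ≥0∞) ^ 2 * φ z.point :=
      (hr.coe_nnreal_ennreal.pow_const 2).mul (hφ.comp hp)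
  · rw [lintegral_proj _ hφ, lintegral_proj _ hφ, lintegral_map hm measurable_fst,
      lintegral_map hm measurable_fst]
    exact (lintegral_dilatedPlan hθ (hm.comp measurable_fst)).trans
      (lintegral_congr fun p => sq_mul_radius_dilation (h0 p) _ _)
  · rw [lintegral_proj _ hφ, lintegral_proj _ hφ, lintegral_map hm measurable_snd,
      lintegral_map hm measurable_snd]
    exact (lintegral_dilatedPlan hθ (hm.comp measurable_snd)).trans
      (lintegral_congr fun p => sq_mul_radius_dilation (h0 p) _ _)

end Dilation

/-- Every plan can be dilated so that its second marginal is concentrated on the radii `0` and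
`1`. -/
theorem IsConePlan.exists_normalized {γ : Measure (Cone X × Cone X)} {μ ν : Measure X}
    (h : IsConePlan γ μ ν) (x₀ : X) : ∃ (γ' : Measure (Cone X × Cone X)) (m : ℝ≥0∞),
      IsConePlan γ' μ ν ∧ planCost γ' = planCost γ ∧ m ≠ ∞ ∧
      γ'.map Prod.snd = ν.map (fun x => Cone.mk x 1) + m • Measure.dirac (Cone.mk x₀ 0) := by
  obtain ⟨hfin, hμ, hν, rfl, rfl⟩ := h
  have hr := Cone.measurable_radius (X := X)
  set S : Set (Cone X × Cone X) := {p | p.2.radius = 0} with hS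
  have hSm : MeasurableSet S := (hr.comp measurable_snd) (measurableSet_singleton 0)
  classical
  -- Dividing by the second radius brings it to 1. Pairs whose second point is the tip are left
  -- alone, so the atom there has mass `γ S`.
  set θ : Cone X × Cone X → ℝ≥0 := fun p => if p.2.radius = 0 then 1 else p.2.radius with hθdef
  have hθ : Measurable θ := Measurable.ite hSm measurable_const (hr.comp measurable_snd)
  have h0 : ∀ p, θ p ≠ 0 := fun p => by
    simp only [hθdef]; split_ifs with h
    · exact one_ne_zero
    · exact h
  have hmk : Measurable fun x : X => Cone.mk x 1 :=
    Cone.continuous_mk.measurable.comp (measurable_id.prodMk measurable_const)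
  have hsnd : (dilatedPlan γ θ).map Prod.snd = (proj (γ.map Prod.snd)).map
      (fun x => Cone.mk x 1) + γ S • Measure.dirac (Cone.mk x₀ 0) := by
    refine Measure.ext_of_lintegral _ fun F hF => ?_
    have hm : Measurable fun z : Cone X => (z.radius : ℝ≥0∞) ^ 2 * F (Cone.mk z.point 1) :=
      (hr.coe_nnreal_ennreal.pow_const 2).mul ((hF.comp hmk).comp Cone.measurable_point)
    rw [lintegral_map hF measurable_snd, lintegral_dilatedPlan (F := fun p => F p.2) hθ
      (hF.comp measurable_snd), lintegral_add_measure, lintegral_map hF hmk,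
      lintegral_proj (φ := fun x => F (Cone.mk x 1)) _ (hF.comp hmk),
      lintegral_map hm measurable_snd, lintegral_smul_measure, lintegral_dirac' _ hF,
      smul_eq_mul, mul_comm (γ S), ← lintegral_indicator_const hSm]
    refine Eq.trans (lintegral_congr fun p => ?_) (lintegral_add_left (hm.comp measurable_snd) _)
    rw [Function.comp_apply]
    by_cases hp : p.2.radius = 0
    · have e : Cone.dilation (1 : ℝ≥0)⁻¹ p.2 = Cone.mk x₀ 0 := by
        rw [Cone.dilation, hp, mul_zero]; exact Cone.mk_zero _ _
      rw [Set.indicator_of_mem (show p ∈ S from hp)]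
      simp only [hθdef, hp, if_true, e, ENNReal.coe_one, ENNReal.coe_zero]
      simp
    · rw [Set.indicator_of_notMem (show p ∉ S from hp)]
      simp only [hθdef, hp, if_false, Cone.dilation, inv_mul_cancel₀ hp, add_zero]
  have hproj := proj_map_dilatedPlan (γ := γ) hθ h0
  refine ⟨dilatedPlan γ θ, γ S, ⟨?_, hμ, hν, hproj.1, hproj.2⟩,
    planCost_dilatedPlan hθ h0, measure_ne_top _ _, hsnd⟩
  -- The density `θ²` is unbounded; finiteness is read off from the explicit second marginal.
  have : IsFiniteMeasure ((dilatedPlan γ θ).map Prod.snd) := by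
    rw [hsnd]
    have := Measure.smul_finite (Measure.dirac (Cone.mk x₀ 0)) (measure_ne_top γ S)
    infer_instance
  exact Measure.isFiniteMeasure_of_map (f := Prod.snd) measurable_snd.aemeasurable

theorem proj_add_smul_dirac_tip (l : Measure (Cone X)) (k : ℝ≥0∞) (x₀ : X) :
    proj (l + k • Measure.dirac (Cone.mk x₀ 0)) = proj l := by
  refine Measure.ext_of_lintegral _ fun φ hφ => ?_
  have hm : Measurable fun z : Cone X => (z.radius : ℝ≥0∞) ^ 2 * φ z.point :=
    (Cone.measurable_radius.coe_nnreal_ennreal.pow_const 2).mul (hφ.comp Cone.measurable_point)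
  rw [lintegral_proj _ hφ, lintegral_proj _ hφ, lintegral_add_measure, lintegral_smul_measure,
    lintegral_dirac' _ hm]
  simp

/-- Mass at the pair of tips can be added to a plan at no cost. -/
theorem IsConePlan.add_tip {γ : Measure (Cone X × Cone X)} {μ ν : Measure X}
    (h : IsConePlan γ μ ν) (x₀ : X) {k : ℝ≥0∞} (hk : k ≠ ∞) :
    IsConePlan (γ + k • Measure.dirac (Cone.mk x₀ 0, Cone.mk x₀ 0)) μ ν ∧
      planCost (γ + k • Measure.dirac (Cone.mk x₀ 0, Cone.mk x₀ 0)) = planCost γ ∧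
      (γ + k • Measure.dirac (Cone.mk x₀ 0, Cone.mk x₀ 0)).map Prod.snd
        = γ.map Prod.snd + k • Measure.dirac (Cone.mk x₀ 0) := by
  obtain ⟨hfin, hμ, hν, rfl, rfl⟩ := h
  have e₁ : (γ + k • Measure.dirac (Cone.mk x₀ 0, Cone.mk x₀ 0)).map Prod.fst
      = γ.map Prod.fst + k • Measure.dirac (Cone.mk x₀ 0) := by
    rw [Measure.map_add _ _ measurable_fst, Measure.map_smul, Measure.map_dirac' measurable_fst]
  have e₂ : (γ + k • Measure.dirac (Cone.mk x₀ 0, Cone.mk x₀ 0)).map Prod.snd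
      = γ.map Prod.snd + k • Measure.dirac (Cone.mk x₀ 0) := by
    rw [Measure.map_add _ _ measurable_snd, Measure.map_smul, Measure.map_dirac' measurable_snd]
  refine ⟨⟨?_, hμ, hν, ?_, ?_⟩, ?_, e₂⟩
  · have := Measure.smul_finite (Measure.dirac (Cone.mk x₀ 0, Cone.mk x₀ 0)) hk
    infer_instance
  · rw [e₁, proj_add_smul_dirac_tip]
  · rw [e₂, proj_add_smul_dirac_tip]
  · rw [planCost, lintegral_add_measure, lintegral_smul_measure,
      lintegral_dirac' _ measurable_edist_sq]
    simp [planCost]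

/-! ### The triangle inequality for `HK` -/

/-- The triangle inequality for plans whose middle marginals agree. -/
theorem hk_le_of_marginal_eq [Nonempty X] {α β : Measure (Cone X × Cone X)} {μ₀ μ₁ μ₂ : Measure X}
    (hα : IsConePlan α μ₀ μ₁) (hβ : IsConePlan β μ₁ μ₂)
    (h : α.map Prod.snd = β.map Prod.fst) :
    hk μ₀ μ₂ ≤ planCost α ^ (1 / 2 : ℝ) + planCost β ^ (1 / 2 : ℝ) := by
  have := hα.finite
  have := hβ.finite
  have : Nonempty (Cone X) := Nonempty.map (fun x => Cone.mk x 0) ‹_›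
  obtain ⟨Γ, hΓα, hΓβ⟩ := exists_glue α β h
  have hm₁ : Measurable fun p : Cone X × Cone X × Cone X => (p.2.1, p.1) := by fun_prop
  have hm₂ : Measurable fun p : Cone X × Cone X × Cone X => (p.1, p.2.2) := by fun_prop
  have hΓ : IsFiniteMeasure Γ := by
    have : IsFiniteMeasure (Γ.map fun p => (p.2.1, p.1)) := by rw [hΓα]; infer_instance
    exact Measure.isFiniteMeasure_of_map hm₁.aemeasurable
  have hplan : IsConePlan (Γ.map Prod.snd) μ₀ μ₂ := by
    refine ⟨inferInstance, hα.finite_left, hβ.finite_right, ?_, ?_⟩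
    · rw [← hα.proj_fst, ← hΓα, Measure.map_map measurable_fst hm₁,
        Measure.map_map measurable_fst measurable_snd]
      rfl
    · rw [← hβ.proj_snd, ← hΓβ, Measure.map_map measurable_snd hm₂,
        Measure.map_map measurable_snd measurable_snd]
      rfl
  refine (hk_le_of_isConePlan hplan).trans ?_
  rw [← hΓα, ← hΓβ, planCost, planCost, planCost, lintegral_map measurable_edist_sq hm₁,
    lintegral_map measurable_edist_sq hm₂, lintegral_map measurable_edist_sq measurable_snd]
  simp only [← ENNReal.rpow_two]
  -- The pointwise triangle inequality in the cone, followed by Minkowski in `L²(Γ)`.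
  refine le_trans (ENNReal.rpow_le_rpow (lintegral_mono fun p => ?_) (by norm_num))
    (ENNReal.lintegral_Lp_add_le (p := 2) (f := fun p : Cone X × Cone X × Cone X => edist p.2.1 p.1)
      (g := fun p : Cone X × Cone X × Cone X => edist p.1 p.2.2)
      (measurable_edist.comp hm₁).aemeasurable
      (measurable_edist.comp hm₂).aemeasurable one_le_two)
  exact ENNReal.rpow_le_rpow (edist_triangle _ _ _) (by norm_num)

theorem hk_triangle (μ₀ μ₁ μ₂ : Measure X) : hk μ₀ μ₂ ≤ hk μ₀ μ₁ + hk μ₁ μ₂ := by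
  rcases isEmpty_or_nonempty X with hX | hX
  · rw [Subsingleton.elim μ₂ μ₁]
    exact le_self_add
  obtain ⟨x₀⟩ := id hX
  refine ENNReal.le_of_forall_pos_le_add fun ε hε hlt => ?_
  have hε' : ((ε / 2 : ℝ≥0) : ℝ≥0∞) ≠ 0 := by simpa using hε.ne'
  obtain ⟨α, hα, hαlt⟩ := exists_isConePlan_of_hk_lt
    (ENNReal.lt_add_right (ne_top_of_le_ne_top hlt.ne le_self_add) hε')
  obtain ⟨β, hβ, hβlt⟩ := exists_isConePlan_of_hk_lt
    (ENNReal.lt_add_right (ne_top_of_le_ne_top hlt.ne le_add_self) hε')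
  obtain ⟨α', m, hα', cα, hm, mα⟩ := hα.exists_normalized x₀
  obtain ⟨β', m', hβ', cβ, hm', mβ⟩ := hβ.swap.exists_normalized x₀
  -- Each plan receives the tip mass of the other, so both middle marginals carry the atom `m + m'`.
  -- The second plan was swapped to bring `μ₁` into second position.
  obtain ⟨hα'', cα', mα'⟩ := hα'.add_tip x₀ hm'
  obtain ⟨hβ'', cβ', mβ'⟩ := hβ'.add_tip x₀ hm
  have key := hk_le_of_marginal_eq hα'' hβ''.swap (by
    rw [Measure.map_map measurable_fst measurable_swap]
    change _ = Measure.map Prod.snd _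
    rw [mα', mβ', mα, mβ, add_assoc, add_assoc, add_comm (m • _)])
  rw [planCost_swap, cα', cα, cβ', cβ, planCost_swap] at key
  refine key.trans ((add_le_add hαlt.le hβlt.le).trans (le_of_eq ?_))
  rw [add_add_add_comm, ← ENNReal.coe_add, add_halves]

/-- `r₀ + r₁` dominates both the cone distance and the interpolated radius, so this one bound gives
finite cost and finite mass of `μ(s)`. -/
theorem IsConePlan.lintegral_radius_sq_lt_top {X : Type*} [MetricSpace X] [MeasurableSpace X]
    [BorelSpace X] [StandardBorelSpace X] [SecondCountableTopology X] {γ : Measure (Cone X × Cone X)}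
    {μ ν : Measure X} (h : IsConePlan γ μ ν) :
    ∫⁻ p, ((p.1.radius + p.2.radius : ℝ≥0) : ℝ≥0∞) ^ 2 ∂γ < ∞ := by
  obtain ⟨_, hμ, hν, rfl, rfl⟩ := h
  have hr : Measurable fun z : Cone X => (z.radius : ℝ≥0∞) ^ 2 :=
    Cone.measurable_radius.coe_nnreal_ennreal.pow_const 2
  rw [isFiniteMeasure_proj_iff, lintegral_map hr measurable_fst] at hμ
  rw [isFiniteMeasure_proj_iff, lintegral_map hr measurable_snd] at hν
  refine lt_of_le_of_lt (lintegral_mono (g := fun p => 2 * ((p.1.radius : ℝ≥0∞) ^ 2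
    + (p.2.radius : ℝ≥0∞) ^ 2)) fun p => ?_) ?_
  · beta_reduce
    exact_mod_cast add_sq_le (a := p.1.radius) (b := p.2.radius)
  · rw [lintegral_const_mul' _ _ (by simp)]
    exact ENNReal.mul_lt_top (by simp) ((lintegral_add_left (hr.comp measurable_fst) _).trans_lt
      (ENNReal.add_lt_top.2 ⟨hμ, hν⟩))

theorem IsConePlan.planCost_lt_top {X : Type*} [MetricSpace X] [MeasurableSpace X] [BorelSpace X]
    [StandardBorelSpace X] [SecondCountableTopology X] {γ : Measure (Cone X × Cone X)}
    {μ ν : Measure X} (h : IsConePlan γ μ ν) : planCost γ < ∞ :=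
  lt_of_le_of_lt (lintegral_mono fun p =>
    pow_le_pow_left' (Cone.edist_le_radius_add_radius p.1 p.2) 2) h.lintegral_radius_sq_lt_top

/-! ### The geodesic -/

section Curve

variable {d : ℕ} {Ω : Set (EuclideanSpace ℝ (Fin d))}

variable (hΩ : Convex ℝ Ω) {γ : Measure (Cone Ω × Cone Ω)}
  {μ₀ μ₁ : Measure Ω}

theorem isFiniteMeasure_curve (hΩ_closed : IsClosed Ω) (h : IsConePlan γ μ₀ μ₁) (s : I) :
    IsFiniteMeasure (curve hΩ γ s) := by
  have : StandardBorelSpace Ω := hΩ_closed.measurableSet.standardBorel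
  rw [curve, isFiniteMeasure_proj_iff, lintegral_map
    (Cone.measurable_radius.coe_nnreal_ennreal.pow_const 2) (measurable_interp hΩ hΩ_closed s)]
  refine lt_of_le_of_lt (lintegral_mono fun p => ?_) h.lintegral_radius_sq_lt_top
  gcongr
  exact radius_interp_le hΩ s p.1 p.2

theorem hk_curve_le (hΩ_closed : IsClosed Ω) (h : IsConePlan γ μ₀ μ₁) (s t : I) :
    hk (curve hΩ γ s) (curve hΩ γ t)
      ≤ ENNReal.ofReal |(t : ℝ) - s| * planCost γ ^ (1 / 2 : ℝ) := by
  have : StandardBorelSpace Ω := hΩ_closed.measurableSet.standardBorel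
  have := h.finite
  have hs := measurable_interp hΩ hΩ_closed s
  have ht := measurable_interp hΩ hΩ_closed t
  have hplan : IsConePlan (γ.map fun p => (interp hΩ s p.1 p.2, interp hΩ t p.1 p.2))
      (curve hΩ γ s) (curve hΩ γ t) := by
    refine ⟨inferInstance, isFiniteMeasure_curve hΩ hΩ_closed h s,
      isFiniteMeasure_curve hΩ hΩ_closed h t, ?_, ?_⟩
    · rw [Measure.map_map measurable_fst (hs.prodMk ht)]; rfl
    · rw [Measure.map_map measurable_snd (hs.prodMk ht)]; rfl
  refine (hk_le_of_isConePlan hplan).trans ?_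
  have hcost : planCost (γ.map fun p => (interp hΩ s p.1 p.2, interp hΩ t p.1 p.2))
      ≤ ENNReal.ofReal |(t : ℝ) - s| ^ 2 * planCost γ := by
    rw [planCost, lintegral_map measurable_edist_sq (hs.prodMk ht), planCost,
      ← lintegral_const_mul _ measurable_edist_sq]
    refine lintegral_mono fun p => ?_
    rw [← mul_pow]
    refine pow_le_pow_left' ?_ 2
    rw [edist_dist, edist_dist, ← ENNReal.ofReal_mul (abs_nonneg _)]
    exact ENNReal.ofReal_le_ofReal (dist_interp_le hΩ s t p.1 p.2)
  refine (ENNReal.rpow_le_rpow hcost (by norm_num)).trans (le_of_eq ?_)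
  rw [ENNReal.mul_rpow_of_nonneg _ _ (by norm_num), ← ENNReal.rpow_natCast, ← ENNReal.rpow_mul]
  norm_num

theorem curve_zero : curve hΩ γ 0 = proj (γ.map Prod.fst) := by
  simp only [curve, interp_zero]

theorem curve_one : curve hΩ γ 1 = proj (γ.map Prod.snd) := by
  simp only [curve, interp_one]

/-- The upper bounds on `[0,s]`, `[s,t]`, `[t,1]` add up to exactly `HK(μ₀, μ₁)`, so by the triangle
inequality the middle one is attained. -/
theorem hk_curve (hΩ_closed : IsClosed Ω) (h : IsConePlan γ μ₀ μ₁)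
    (hopt : planCost γ ^ (1 / 2 : ℝ) = hk μ₀ μ₁)
    (hfin : hk μ₀ μ₁ ≠ ∞) (s t : I) :
    hk (curve hΩ γ s) (curve hΩ γ t) = ENNReal.ofReal |(t : ℝ) - s| * hk μ₀ μ₁ := by
  have : StandardBorelSpace Ω := hΩ_closed.measurableSet.standardBorel
  have hle := hk_curve_le hΩ hΩ_closed h
  rw [hopt] at hle
  have h0 : curve hΩ γ 0 = μ₀ := (curve_zero hΩ).trans h.proj_fst
  have h1 : curve hΩ γ 1 = μ₁ := (curve_one hΩ).trans h.proj_snd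
  wlog hst : s ≤ t generalizing s t
  · rw [hk_comm, this t s (le_of_not_ge hst), abs_sub_comm]
  have hst' : 0 ≤ (t : ℝ) - s := sub_nonneg.2 (Subtype.coe_le_coe.2 hst)
  refine le_antisymm (hle s t) ?_
  have hs := hle 0 s
  have ht := hle t 1
  rw [h0, Set.Icc.coe_zero, sub_zero, abs_of_nonneg s.2.1] at hs
  rw [h1, Set.Icc.coe_one, abs_of_nonneg (sub_nonneg.2 t.2.2)] at ht
  rw [abs_of_nonneg hst']
  have htri : hk μ₀ μ₁ ≤ ENNReal.ofReal s * hk μ₀ μ₁ + (hk (curve hΩ γ s) (curve hΩ γ t)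
      + ENNReal.ofReal (1 - t) * hk μ₀ μ₁) :=
    (hk_triangle _ (curve hΩ γ s) _).trans (add_le_add hs
      ((hk_triangle _ (curve hΩ γ t) _).trans (add_le_add_right ht _)))
  have hsplit : hk μ₀ μ₁ = ENNReal.ofReal s * hk μ₀ μ₁ + (ENNReal.ofReal (t - s) * hk μ₀ μ₁
      + ENNReal.ofReal (1 - t) * hk μ₀ μ₁) := by
    rw [← add_mul, ← add_mul, ← ENNReal.ofReal_add hst' (sub_nonneg.2 t.2.2),
      ← ENNReal.ofReal_add s.2.1 (by linarith [t.2.2])]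
    simp
  have hf : ∀ a : ℝ, ENNReal.ofReal a * hk μ₀ μ₁ ≠ ∞ := fun a =>
    ENNReal.mul_ne_top ENNReal.ofReal_ne_top hfin
  -- Cancelling the two outer terms in `ℝ≥0∞` requires them to be finite.
  nth_rewrite 1 [hsplit] at htri
  exact (ENNReal.add_le_add_iff_right (hf _)).1 ((ENNReal.add_le_add_iff_left (hf _)).1 htri)

end Curve

end HellingerKantorovich

end

open HellingerKantorovich

theorem mainTheorem5 {d : ℕ} (Ω : Set (EuclideanSpace ℝ (Fin d))) (hΩ_closed : IsClosed Ω)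
    (hΩ : Convex ℝ Ω) (μ₀ μ₁ : Measure Ω) [IsFiniteMeasure μ₀] [IsFiniteMeasure μ₁]
    (l₀ l₁ : Measure (HellingerKantorovich.Cone Ω))
    (hl : HellingerKantorovich.AreOptimalLifts l₀ l₁ μ₀ μ₁)
    (γ : Measure (HellingerKantorovich.Cone Ω × HellingerKantorovich.Cone Ω))
    (hγ : HellingerKantorovich.IsOptimalPlan γ l₀ l₁) :
    (∀ s : I, IsFiniteMeasure (HellingerKantorovich.curve hΩ γ s)) ∧
    HellingerKantorovich.curve hΩ γ 0 = μ₀ ∧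
    HellingerKantorovich.curve hΩ γ 1 = μ₁ ∧
    HellingerKantorovich.hk μ₀ μ₁ ≠ ∞ ∧
    ∀ s t : I,
      HellingerKantorovich.hk (HellingerKantorovich.curve hΩ γ s)
          (HellingerKantorovich.curve hΩ γ t)
        = ENNReal.ofReal |(t : ℝ) - s| * HellingerKantorovich.hk μ₀ μ₁ := by
  have : StandardBorelSpace Ω := hΩ_closed.measurableSet.standardBorel
  have h : IsConePlan γ μ₀ μ₁ :=
    ⟨hγ.plan.finite, inferInstance, inferInstance, by rw [hγ.plan.map_fst, hl.lift₀.2],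
      by rw [hγ.plan.map_snd, hl.lift₁.2]⟩
  have hopt : planCost γ ^ (1 / 2 : ℝ) = hk μ₀ μ₁ := by
    rw [← hl.optimal, hγ.optimal, ← ENNReal.rpow_natCast, ← ENNReal.rpow_mul]
    norm_num
  have hfin : hk μ₀ μ₁ ≠ ∞ := by
    rw [← hopt]
    exact ENNReal.rpow_ne_top_of_nonneg (by norm_num) h.planCost_lt_top.ne
  exact ⟨isFiniteMeasure_curve hΩ hΩ_closed h, (curve_zero hΩ).trans h.proj_fst,
    (curve_one hΩ).trans h.proj_snd, hfin, hk_curve hΩ hΩ_closed h hopt hfin⟩
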